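/- Let $n\ge 0$, $G_{\mathbb R}=\mathrm{SL}_n(\mathbb R)$ with Lie algebra $\mathfrak g_{\mathbb R}=\mathfrak{sl}_n(\mathbb R)$, and $G=\mathrm{SL}_n(\mathbb C)$ with Lie algebra $\mathfrak g=\mathfrak{sl}_n(\mathbb C)\supset\mathfrak g_{\mathbb R}$; both groups act on their Lie algebras by the adjoint action $g\cdot z=gzg^{-1}$. Let $x\in\mathfrak g_{\mathbb R}$ be a hyperbolic semisimple element, i.e. $\mathrm{ad}(x):\mathfrak g_{\mathbb R}\to\mathfrak g_{\mathbb R}$ is diagonalizable with real eigenvalues. Put $$\lim_{\nu\to 0^+}G_{\mathbb R}\cdot(\nu x):=\bigcap_{\epsilon>0}\overline{\bigcup_{\nu\in(0,\epsilon)}G_{\mathbb R}\cdot(\nu x)}$$ (closure in the usual topology of $\mathfrak g_{\mathbb R}$) and $$\mathfrak u(x):=\bigoplus_{\mu>0}\{z\in\mathfrak g\mid [x,z]=\mu z\},$$ the nilradical of the parabolic subalgebra $\bigoplus_{\mu\ge 0}\{z\in\mathfrak g\mid [x,z]=\mu z\}$. Then there is a unique $G$-orbit $\mathcal O_{\mathrm{Rich}}(x)$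 in $G\cdot\mathfrak u(x)$ that is Zariski dense in $G\cdot\mathfrak u(x)$ (the Richardson orbit of $x$), and $$\lim_{\nu\to 0^+}G_{\mathbb R}\cdot(\nu x)=(G\cdot\mathfrak u(x))\cap\mathfrak g_{\mathbb R}=\overline{\mathcal O_{\mathrm{Rich}}(x)}\cap\mathfrak g_{\mathbb R},$$ where $\overline{\mathcal O_{\mathrm{Rich}}(x)}$ is the Zariski closure of $\mathcal O_{\mathrm{Rich}}(x)$ in $\mathfrak g$. -/

import Mathlib

open LieAlgebra.SpecialLinear (sl)

namespace AdjointLimit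

attribute [local instance 100] LieRing.ofAssociativeRing

section General

variable {n : ℕ} {𝕜 : Type*} [Field 𝕜]

/-- The adjoint action `Ad(g) z = g z g⁻¹` of `SL_n(𝕜)` on its Lie algebra `sl_n(𝕜)`. -/
def Ad (g : Matrix.SpecialLinearGroup (Fin n) 𝕜) (z : sl (Fin n) 𝕜) : sl (Fin n) 𝕜 :=
  ⟨(g : Matrix (Fin n) (Fin n) 𝕜) * (z : Matrix (Fin n) (Fin n) 𝕜) *
      ((g⁻¹ : Matrix.SpecialLinearGroup (Fin n) 𝕜) : Matrix (Fin n) (Fin n) 𝕜), by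
    have hz : Matrix.trace (z : Matrix (Fin n) (Fin n) 𝕜) = 0 := LinearMap.mem_ker.1 z.2
    refine LinearMap.mem_ker.2 ?_
    rw [Matrix.traceLinearMap_apply, Matrix.trace_mul_comm, ← mul_assoc,
      ← Matrix.SpecialLinearGroup.coe_mul, inv_mul_cancel,
      Matrix.SpecialLinearGroup.coe_one, one_mul, hz]⟩

/-- The adjoint orbit `SL_n(𝕜) · z`. -/
def orbit (z : sl (Fin n) 𝕜) : Set (sl (Fin n) 𝕜) :=
  {w | ∃ g : Matrix.SpecialLinearGroup (Fin n) 𝕜, w = Ad g z}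

/-- The union `SL_n(𝕜) · S` of the adjoint orbits of the elements of `S`. -/
def saturation (S : Set (sl (Fin n) 𝕜)) : Set (sl (Fin n) 𝕜) :=
  {w | ∃ z ∈ S, w ∈ orbit z}

/-- The closure of a subset of `sl_n(𝕜)` in the Zariski topology: the common zeros in `sl_n(𝕜)` of
all polynomials in the matrix entries that vanish on `S`. -/
def zariskiClosure (S : Set (sl (Fin n) 𝕜)) : Set (sl (Fin n) 𝕜) :=
  {z | ∀ p : MvPolynomial (Fin n × Fin n) 𝕜,
    (∀ w ∈ S, MvPolynomial.eval (fun i => (w : Matrix (Fin n) (Fin n) 𝕜) i.1 i.2) p = 0) →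
      MvPolynomial.eval (fun i => (z : Matrix (Fin n) (Fin n) 𝕜) i.1 i.2) p = 0}

end General

variable {n : ℕ}

/-- The limit of orbits `lim_{ν → 0⁺} SL_n(ℝ) · (ν x)`: the intersection over all `ε > 0` of the
closures, in the usual topology of `sl_n(ℝ)`, of `⋃_{0 < ν < ε} SL_n(ℝ) · (ν x)`. -/
def orbitLimit (x : sl (Fin n) ℝ) : Set (sl (Fin n) ℝ) :=
  ⋂ ε ∈ Set.Ioi (0 : ℝ), closure (⋃ ν ∈ Set.Ioo (0 : ℝ) ε, orbit (ν • x))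

/-- `x ∈ sl_n(ℝ)` is semisimple and hyperbolic: `ad x` is diagonalizable with real eigenvalues,
i.e. `sl_n(ℝ)` is spanned by eigenvectors of `ad x` with real eigenvalues. -/
def IsHyperbolicSemisimple (x : sl (Fin n) ℝ) : Prop :=
  ⨆ μ : ℝ, (LieAlgebra.ad ℝ (sl (Fin n) ℝ) x).eigenspace μ = ⊤

/-- The inclusion of `sl_n(ℝ)` into its complexification `sl_n(ℂ)`. -/
def complexify (x : sl (Fin n) ℝ) : sl (Fin n) ℂ :=
  ⟨(x : Matrix (Fin n) (Fin n) ℝ).map Complex.ofReal, by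
    have hx : Matrix.trace (x : Matrix (Fin n) (Fin n) ℝ) = 0 := LinearMap.mem_ker.1 x.2
    refine LinearMap.mem_ker.2 ?_
    have h : Matrix.trace ((x : Matrix (Fin n) (Fin n) ℝ).map Complex.ofReal) =
        ((Matrix.trace (x : Matrix (Fin n) (Fin n) ℝ) : ℝ) : ℂ) := by
      simp [Matrix.trace]
    rw [Matrix.traceLinearMap_apply, h, hx, Complex.ofReal_zero]⟩

/-- `sl_n(ℝ)` as a subset of `sl_n(ℂ)`. -/
def realForm (n : ℕ) : Set (sl (Fin n) ℂ) := Set.range (complexify (n := n))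

/-- The space `u(x) = ⨁_{μ > 0} {z ∈ sl_n(ℂ) | [x, z] = μ z}`, the nilradical of the parabolic
subalgebra `⨁_{μ ≥ 0} {z ∈ sl_n(ℂ) | [x, z] = μ z}` of a hyperbolic semisimple `x`. -/
def nilradical (x : sl (Fin n) ℝ) : Submodule ℂ (sl (Fin n) ℂ) :=
  ⨆ μ ∈ Set.Ioi (0 : ℝ),
    (LieAlgebra.ad ℂ (sl (Fin n) ℂ) (complexify x)).eigenspace (μ : ℂ)

/-- The Richardson orbit of a hyperbolic semisimple `x`: the `SL_n(ℂ)`-orbit contained in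
`SL_n(ℂ) · u(x)` and Zariski dense in it. It is written here as the set of all the elements of
`SL_n(ℂ) · u(x)` whose orbit is dense in `SL_n(ℂ) · u(x)`; that these elements form exactly one
orbit is asserted together with the theorem. -/
def richardsonOrbit (x : sl (Fin n) ℝ) : Set (sl (Fin n) ℂ) :=
  {z | z ∈ saturation (nilradical x : Set (sl (Fin n) ℂ)) ∧
    saturation (nilradical x : Set (sl (Fin n) ℂ)) ⊆ zariskiClosure (orbit z)}

end AdjointLimit

/-! Let `d` be the list of eigenvalues of `x`, which is diagonalizable over ℝ
(`IsHyperbolicSemisimple.exists_diagonal`). All the sets in the theorem are cut out by one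
condition, `RankBound d`: for every set S of eigenvalues, z^|S| has rank at most the number of
indices i with d i outside S.

The condition is necessary in a limit: if y is similar to ν·diag(d), then the product of the y − νs
over s in S has at most this rank, it tends to z^|S| as (ν, y) → (0, z), and rank bounds are closed
conditions (`rank_pow_le_of_mem_closure`). A strictly block triangular w is such a limit, since
ν·diag(d) + w is similar to ν·diag(d) for ν ≠ 0 (`IsStrictBlock.diagonal_add_similar`); hence G·u(x)
satisfies the bounds too.

It is sufficient because the bounds allow a basis to be built in which z is strictly block
triangular (`RankBound.exists_isStrictBlock`, resting on `exists_adapted_family`). Over ℂ this puts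
z in G·u(x); over ℝ, adding a small multiple of the conjugated diagonal matrix exhibits z as a limit
of points of the orbits of νx.

For the Richardson orbit, the ranks of all powers are simultaneously maximal on a nonempty Zariski
open part of u(x), and these ranks determine a nilpotent orbit (`exists_generic_orbit`). This orbit
is dense in G·u(x), which is Zariski closed because rank bounds are polynomial equations. -/

namespace AdjointLimit

/-! ### Nilpotent endomorphisms are classified by the ranks of their powers. -/

section NilpotentSimilarity

open Module LinearMap

variable {K : Type*} [Field K]

/-- The endomorphism induced by `A` on its range. -/
def onRange {V : Type*} [AddCommGroup V] [Module K V] (A : End K V) : End K (range A) :=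
  A.rangeRestrict ∘ₗ (range A).subtype

theorem coe_onRange {V : Type*} [AddCommGroup V] [Module K V] (A : End K V) (w : range A) :
    (onRange A w : V) = A w := rfl

theorem coe_onRange_pow {V : Type*} [AddCommGroup V] [Module K V] (A : End K V) (j : ℕ)
    (w : range A) : ((onRange A ^ j) w : V) = (A ^ j) w := by
  induction j generalizing w with
  | zero => simp
  | succ j ih => simp [pow_succ, ih, coe_onRange]

theorem finrank_range_onRange_pow {V : Type*} [AddCommGroup V] [Module K V] (A : End K V)
    (j : ℕ) : finrank K (range (onRange A ^ j)) = finrank K (range (A ^ (j + 1))) := by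
  have h : (range (onRange A ^ j)).map (range A).subtype = range (A ^ (j + 1)) := by
    ext v
    constructor
    · rintro ⟨_, ⟨⟨_, w, rfl⟩, rfl⟩, rfl⟩
      exact ⟨w, by simp [coe_onRange_pow, pow_succ]⟩
    · rintro ⟨w, rfl⟩
      exact ⟨_, ⟨⟨A w, w, rfl⟩, rfl⟩, by simp [coe_onRange_pow, pow_succ]⟩
  rw [← h, Submodule.finrank_map_subtype_eq]

/-- The kernel of `A` is the direct sum of its part in the range of `A` and a subspace `C`, and `C`
has a complement containing the range. -/
theorem exists_ker_decomposition {V : Type*} [AddCommGroup V] [Module K V]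
    [FiniteDimensional K V] (A : End K V) :
    ∃ C E : Submodule K V, C ≤ ker A ∧ range A ≤ E ∧ IsCompl C E ∧ C ⊔ (ker A ⊓ range A) = ker A ∧
      finrank K C + finrank K (ker A ⊓ range A : Submodule K V) = finrank K (ker A) := by
  obtain ⟨X, hX⟩ := Submodule.exists_isCompl (ker A ⊓ range A)
  have hsup : (X ⊓ ker A) ⊔ (ker A ⊓ range A) = ker A := by
    rw [sup_comm, ← sup_inf_assoc_of_le _ (inf_le_left : ker A ⊓ range A ≤ ker A), hX.sup_eq_top,
      top_inf_eq]
  have hdis : Disjoint (range A) (X ⊓ ker A) := by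
    rw [disjoint_iff, ← le_bot_iff, ← hX.inf_eq_bot]
    exact fun v hv => ⟨⟨hv.2.2, hv.1⟩, hv.2.1⟩
  obtain ⟨E, hE, hc⟩ := hdis.exists_isCompl
  refine ⟨X ⊓ ker A, E, inf_le_right, hE, hc.symm, hsup, ?_⟩
  have h := Submodule.finrank_sup_add_finrank_inf_eq (X ⊓ ker A) (ker A ⊓ range A)
  rw [hsup] at h
  have h0 : (X ⊓ ker A) ⊓ (ker A ⊓ range A) = ⊥ := by
    rw [← le_bot_iff, ← hX.inf_eq_bot]
    exact fun v hv => ⟨hv.2, hv.1.1⟩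
  rw [h0, finrank_bot] at h
  omega

/-- An isomorphism between the ranges of two endomorphisms that intertwines them extends to an
isomorphism of the whole spaces that intertwines them, if these have the same dimension. -/
theorem exists_equiv_of_range_equiv {V W : Type*} [AddCommGroup V] [Module K V]
    [FiniteDimensional K V] [AddCommGroup W] [Module K W] [FiniteDimensional K W]
    (A : End K V) (B : End K W) (hd : finrank K V = finrank K W)
    (φ : range A ≃ₗ[K] range B) (hφ : ∀ v, φ (onRange A v) = onRange B (φ v)) :
    ∃ e : V ≃ₗ[K] W, ∀ v, e (A v) = B (e v) := by
  obtain ⟨C, E, hCK, hRE, hCE, hsup, hC⟩ := exists_ker_decomposition A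
  obtain ⟨D, F, hDK, hRF, hDF, -, hD⟩ := exists_ker_decomposition B
  have hφ' : ∀ v : range A, (φ (onRange A v) : W) = B (φ v) := fun v => by
    rw [hφ, coe_onRange]
  have hr : finrank K (range A) = finrank K (range B) := φ.finrank_eq
  have hk : finrank K (ker A) = finrank K (ker B) := by
    have h1 := A.finrank_range_add_finrank_ker
    have h2 := B.finrank_range_add_finrank_ker
    omega
  have hkr : finrank K (ker A ⊓ range A : Submodule K V) =
      finrank K (ker B ⊓ range B : Submodule K W) := by
    have h1 : ker A ⊓ range A = (ker (onRange A)).map (range A).subtype := by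
      ext v
      constructor
      · rintro ⟨h, h'⟩
        exact ⟨⟨v, h'⟩, Subtype.ext h, rfl⟩
      · rintro ⟨v, h, rfl⟩
        exact ⟨congrArg Subtype.val h, v.2⟩
    have h2 : ker B ⊓ range B = ((ker (onRange A)).map φ.toLinearMap).map (range B).subtype := by
      ext v
      constructor
      · rintro ⟨h, h'⟩
        refine ⟨⟨v, h'⟩, ⟨φ.symm ⟨v, h'⟩, ?_, by simp⟩, rfl⟩
        refine φ.injective (Subtype.ext ?_)
        rw [hφ', φ.apply_symm_apply, map_zero]
        exact h
      · rintro ⟨_, ⟨v, h, rfl⟩, rfl⟩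
        refine ⟨?_, (φ v).2⟩
        change B (φ v) = 0
        rw [← hφ', mem_ker.1 h, map_zero]
        rfl
    rw [h1, h2, Submodule.finrank_map_subtype_eq, Submodule.finrank_map_subtype_eq,
      LinearEquiv.finrank_map_eq]
  let ψ : C ≃ₗ[K] D := LinearEquiv.ofFinrankEq C D (by omega)
  obtain ⟨pr, hpr⟩ := exists_leftInverse_of_injective (range A).subtype (Submodule.ker_subtype _)
  obtain ⟨σ, hσ⟩ := exists_rightInverse_of_surjective B.rangeRestrict (range_rangeRestrict B)
  have hpr' : ∀ w : range A, pr w = w := fun w => LinearMap.congr_fun hpr w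
  have hσ' : ∀ w : range B, B (σ w) = w := fun w =>
    congrArg Subtype.val (LinearMap.congr_fun hσ w)
  let P : V →ₗ[K] V := (range A).subtype ∘ₗ pr
  -- `Φ₀` extends `φ` and satisfies B ∘ Φ₀ = φ ∘ A: the component of v off the range of A is sent to
  -- a B-preimage, chosen by `σ`, of the required value. It need not be injective.
  let Φ₀ : V →ₗ[K] W := (range B).subtype ∘ₗ φ.toLinearMap ∘ₗ pr +
    σ ∘ₗ φ.toLinearMap ∘ₗ A.rangeRestrict ∘ₗ (LinearMap.id - P)
  have hΦ₀B : ∀ v, B (Φ₀ v) = φ (A.rangeRestrict v) := by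
    intro v
    have h1 : A.rangeRestrict v = onRange A (pr v) + A.rangeRestrict (v - pr v) := by
      apply Subtype.ext
      simp [coe_onRange]
    have h2 : Φ₀ v = φ (pr v) + σ (φ (A.rangeRestrict (v - pr v))) := rfl
    rw [h2, map_add, hσ', h1, map_add, Submodule.coe_add, hφ']
  have hΦ₀R : ∀ w : range A, Φ₀ w = φ w := by
    intro w
    have h2 : Φ₀ w = φ (pr w) + σ (φ (A.rangeRestrict (w - pr w))) := rfl
    rw [h2, hpr', sub_self, map_zero, map_zero, map_zero, add_zero]
  -- Since A kills C and B kills D, replacing `Φ₀` by `ψ` on C preserves the intertwining relation.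
  -- Injectivity follows because D meets F, which contains the range of B, only in zero.
  let Φ : V →ₗ[K] W := ofIsCompl hCE (D.subtype ∘ₗ ψ.toLinearMap) (Φ₀ ∘ₗ E.subtype)
  have hΦC : ∀ c : C, Φ c = ψ c := fun c => by simp [Φ]
  have hΦE : ∀ c : E, Φ c = Φ₀ c := fun c => by simp [Φ]
  have hΦR : ∀ w : range A, Φ w = φ w := fun w => by
    rw [← hΦ₀R, ← hΦE ⟨w, hRE w.2⟩]
  have hΦB : ∀ v, B (Φ v) = φ (A.rangeRestrict v) := by
    intro v
    have hv : v ∈ C ⊔ E := by rw [hCE.sup_eq_top]; trivial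
    obtain ⟨c, hc, f, hf, rfl⟩ := Submodule.mem_sup.1 hv
    have h1 : A.rangeRestrict c = 0 := Subtype.ext (hCK hc)
    rw [map_add, map_add, map_add, h1, zero_add, hΦC ⟨c, hc⟩, hΦE ⟨f, hf⟩, hΦ₀B]
    rw [mem_ker.1 (hDK (ψ ⟨c, hc⟩).2), zero_add]
  have hinj : ker Φ = ⊥ := by
    rw [Submodule.eq_bot_iff]
    intro v hv
    have h1 : A v = 0 := by
      have h := hΦB v
      rw [mem_ker.1 hv, map_zero] at h
      have h' : φ (A.rangeRestrict v) = 0 := Subtype.ext h.symm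
      exact congrArg Subtype.val (φ.map_eq_zero_iff.1 h')
    have h2 : v ∈ C ⊔ (ker A ⊓ range A) := by rw [hsup]; exact h1
    obtain ⟨c, hc, f, hf, rfl⟩ := Submodule.mem_sup.1 h2
    have h3 : (ψ ⟨c, hc⟩ : W) = - φ ⟨f, hf.2⟩ := by
      rw [← hΦC, ← hΦR, eq_neg_iff_add_eq_zero, ← map_add]
      exact hv
    have h4 : (ψ ⟨c, hc⟩ : W) = 0 := by
      have h5 : (ψ ⟨c, hc⟩ : W) ∈ D ⊓ F :=
        ⟨(ψ ⟨c, hc⟩).2, by rw [h3]; exact F.neg_mem (hRF (φ ⟨f, hf.2⟩).2)⟩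
      rwa [hDF.inf_eq_bot] at h5
    have h5 : c = 0 := congrArg Subtype.val (ψ.map_eq_zero_iff.1 (Subtype.ext h4))
    have h6 : φ ⟨f, hf.2⟩ = 0 := Subtype.ext (by rw [h4] at h3; simpa using h3.symm)
    have h7 : f = 0 := congrArg Subtype.val (φ.map_eq_zero_iff.1 h6)
    rw [h5, h7, add_zero]
  refine ⟨Φ.linearEquivOfInjective (ker_eq_bot.1 hinj) hd, fun v => ?_⟩
  rw [linearEquivOfInjective_apply, linearEquivOfInjective_apply, hΦB]
  exact hΦR (A.rangeRestrict v)

/-- Nilpotent endomorphisms whose powers have the same ranks are similar. -/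
theorem exists_equiv_of_finrank_range_pow_eq {V W : Type*} [AddCommGroup V] [Module K V]
    [FiniteDimensional K V] [AddCommGroup W] [Module K W] [FiniteDimensional K W]
    (A : End K V) (B : End K W)
    (h : ∀ j, finrank K (range (A ^ j)) = finrank K (range (B ^ j)))
    (hn : ∃ N, finrank K (range (A ^ N)) = 0) :
    ∃ e : V ≃ₗ[K] W, ∀ v, e (A v) = B (e v) := by
  obtain ⟨N, hN⟩ := hn
  have hd : finrank K V = finrank K W := by
    have h0 := h 0
    rwa [pow_zero, pow_zero, Module.End.one_eq_id, Module.End.one_eq_id, range_id, range_id,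
      finrank_top, finrank_top] at h0
  induction N generalizing V W with
  | zero =>
    rw [pow_zero, Module.End.one_eq_id, range_id, finrank_top] at hN
    have := finrank_zero_iff.1 hN
    exact ⟨LinearEquiv.ofFinrankEq V W hd, fun v => by rw [Subsingleton.elim v 0]; simp⟩
  | succ N ih =>
    obtain ⟨φ, hφ⟩ := ih (onRange A) (onRange B)
      (fun j => by rw [finrank_range_onRange_pow, finrank_range_onRange_pow, h])
      (by rw [finrank_range_onRange_pow, hN])
      (by have h1 := h 1; rwa [pow_one, pow_one] at h1)
    exact exists_equiv_of_range_equiv A B hd φ hφ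

end NilpotentSimilarity

/-! ### Bases making an endomorphism strictly block triangular, from rank bounds. -/

section AdaptedBasis

open Module LinearMap

variable {K V : Type*} [Field K] [AddCommGroup V] [Module K V] [FiniteDimensional K V]

theorem finrank_map_add_finrank_inf_ker (f : End K V) (W : Submodule K V) :
    finrank K (W.map f) + finrank K (W ⊓ ker f : Submodule K V) = finrank K W := by
  have h := (f.domRestrict W).finrank_range_add_finrank_ker
  rw [range_domRestrict, ker_domRestrict, ← Submodule.finrank_map_subtype_eq W,
    Submodule.map_comap_subtype] at h
  exact h

theorem exists_finrank_eq_between {C D : Submodule K V} (h : C ≤ D) {m : ℕ}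
    (hC : finrank K C ≤ m) (hD : m ≤ finrank K D) :
    ∃ W, C ≤ W ∧ W ≤ D ∧ finrank K W = m := by
  induction m, hC using Nat.le_induction with
  | base => exact ⟨C, le_rfl, h, rfl⟩
  | succ m _ ih =>
    obtain ⟨W, hCW, hWD, hW⟩ := ih (by omega)
    obtain ⟨v, hv, hvW⟩ : ∃ v ∈ D, v ∉ W := by
      by_contra! hcon
      have := Submodule.finrank_mono (show D ≤ W from hcon)
      omega
    exact ⟨W ⊔ Submodule.span K {v}, hCW.trans le_sup_left,
      sup_le hWD ((Submodule.span_singleton_le_iff_mem _ _).2 hv),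
      by rw [Submodule.finrank_sup_span_singleton hvW, hW]⟩

/-- An ascending chain of subspaces can be refined by a subspace of any given dimension. -/
theorem exists_finrank_eq_comparable {C : ℕ → Submodule K V} (hC : Monotone C) {m N : ℕ}
    (h0 : finrank K (C 0) ≤ m) (hN : m ≤ finrank K (C N)) :
    ∃ W, C 0 ≤ W ∧ W ≤ C N ∧ finrank K W = m ∧ ∀ j, W ≤ C j ∨ C j ≤ W := by
  classical
  -- W is squeezed between the first member of dimension at least m and its predecessor, hence is
  -- comparable with every member.
  have hex : ∃ j, m ≤ finrank K (C j) := ⟨N, hN⟩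
  have hle : Nat.find hex ≤ N := Nat.find_min' hex hN
  rcases hj : Nat.find hex with _ | k
  · have h := Nat.find_spec hex
    rw [hj] at h
    exact ⟨C 0, le_rfl, hC (Nat.zero_le _), le_antisymm h0 h, fun j => .inl (hC (Nat.zero_le _))⟩
  · have h := Nat.find_spec hex
    have h' : finrank K (C k) < m := not_le.1 (Nat.find_min hex (by omega))
    rw [hj] at h
    obtain ⟨W, h1, h2, h3⟩ := exists_finrank_eq_between (hC k.le_succ) h'.le h
    refine ⟨W, (hC k.zero_le).trans h1, h2.trans (hC (by omega)), h3, fun j => ?_⟩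
    rcases Nat.lt_or_ge k j with hkj | hkj
    · exact .inl (h2.trans (hC hkj))
    · exact .inr ((hC hkj).trans h1)

/-- If the ranks of the powers of `A` on an invariant subspace `W` are bounded by the sums of the
block sizes given by `d`, then `W` is spanned by a family in which `A` is strictly block
triangular. -/
theorem exists_adapted_family {ι α : Type*} [LinearOrder α] (d : ι → α)
    (A : End K V) (T : Finset ι) (W : Submodule K V) (hAW : W.map A ≤ W)
    (hcard : finrank K W = T.card)
    (hrank : ∀ S ⊆ T.image d,
      finrank K (W.map (A ^ S.card)) ≤ (T.filter fun i => d i ∉ S).card) :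
    ∃ b : ι → V, Submodule.span K (b '' T) = W ∧
      ∀ j ∈ T, A (b j) ∈ Submodule.span K (b '' {i | i ∈ T ∧ d j < d i}) := by
  classical
  induction hN : T.card using Nat.strong_induction_on generalizing T W with
  | _ N ih =>
  rcases T.eq_empty_or_nonempty with rfl | hT
  · have hW : W = ⊥ := Submodule.finrank_eq_zero.1 (by simpa using hcard)
    exact ⟨0, by simp [hW], by simp⟩
  obtain ⟨i₀, hi₀, hmin⟩ := T.exists_min_image d hT
  set T' := T.filter fun i => d i ≠ d i₀ with hT'
  have hlt : T'.card < T.card := Finset.card_lt_card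
    (Finset.filter_ssubset.2 ⟨i₀, hi₀, by simp⟩)
  have hsplit : T'.card + (T \ T').card = T.card := by
    rw [add_comm]; exact Finset.card_sdiff_add_card_eq_card (Finset.filter_subset _ _)
  -- The lowest block is split off: W' must contain A(W), have the total size of the other blocks,
  -- and inherit the rank bounds. Comparability with every term of this chain ensures the last.
  let C : ℕ → Submodule K V := fun j => W.map A ⊔ (W ⊓ ker (A ^ j))
  have hC : Monotone C := by
    refine monotone_nat_of_le_succ fun j => sup_le_sup_left (inf_le_inf_left _ ?_) _
    intro v hv
    rw [mem_ker, pow_succ', Module.End.mul_apply, mem_ker.1 hv, map_zero]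
  have h0 : finrank K (C 0) ≤ T'.card := by
    have h1 := hrank {d i₀} (by simpa using ⟨i₀, hi₀, rfl⟩)
    simp only [Finset.mem_singleton] at h1
    have h2 : C 0 = W.map A := by
      simp [C, Module.End.one_eq_id]
    rw [h2]
    exact h1
  have hCN : C (T.image d).card = W := by
    have h1 := hrank _ (Finset.Subset.refl _)
    have h2 : T.filter (fun i => d i ∉ T.image d) = ∅ :=
      Finset.filter_eq_empty_iff.2 fun i hi => not_not.2 (Finset.mem_image_of_mem d hi)
    rw [h2, Finset.card_empty, Nat.le_zero, Submodule.finrank_eq_zero] at h1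
    have h3 : W ≤ ker (A ^ (T.image d).card) := LinearMap.le_ker_iff_map.2 h1
    simp only [C, inf_eq_left.2 h3]
    exact sup_eq_right.2 hAW
  obtain ⟨W', hW0, hWN, hW', hcomp⟩ := exists_finrank_eq_comparable hC h0 (N := (T.image d).card)
    (by rw [hCN, hcard]; exact hlt.le)
  rw [hCN] at hWN
  have hAW' : W.map A ≤ W' := le_sup_left.trans hW0
  obtain ⟨b', hb', hAb'⟩ := ih T'.card (hN ▸ hlt) T' W'
    ((Submodule.map_mono hWN).trans hAW') hW' (by
      intro S hS
      have hmS : d i₀ ∉ S := fun h => by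
        obtain ⟨i, hi, hi'⟩ := Finset.mem_image.1 (hS h)
        exact (Finset.mem_filter.1 hi).2 hi'
      have hST : S ⊆ T.image d := hS.trans (Finset.image_subset_image (Finset.filter_subset _ _))
      -- If W' lies in the term of index |S|, then A^|S| maps it into A^(|S|+1)(W), and the bound
      -- for S with the lowest block added applies. Otherwise W' contains W ∩ ker A^|S|, so passing
      -- from W to W' lowers the rank of A^|S| by the full size of the lowest block.
      rcases hcomp S.card with h | h
      · have h1 := hrank (insert (d i₀) S)
          (Finset.insert_subset (Finset.mem_image_of_mem d hi₀) hST)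
        rw [Finset.card_insert_of_notMem hmS] at h1
        have h2 : T.filter (fun i => d i ∉ insert (d i₀) S) = T'.filter fun i => d i ∉ S := by
          ext i; simp [hT']; tauto
        rw [h2] at h1
        refine (Submodule.finrank_mono ?_).trans h1
        refine (Submodule.map_mono h).trans ?_
        rw [Submodule.map_sup]
        refine sup_le ?_ ?_
        · rw [pow_succ, Module.End.mul_eq_comp, Submodule.map_comp]
        · rw [LinearMap.le_ker_iff_map.1 inf_le_right]
          exact bot_le
      · have h1 := hrank S hST
        have h2 := finrank_map_add_finrank_inf_ker (A ^ S.card) W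
        have h3 := finrank_map_add_finrank_inf_ker (A ^ S.card) W'
        have h4 : finrank K (W ⊓ ker (A ^ S.card) : Submodule K V) ≤
            finrank K (W' ⊓ ker (A ^ S.card) : Submodule K V) :=
          Submodule.finrank_mono (le_inf (le_sup_right.trans h) inf_le_right)
        have h5 : (T.filter fun i => d i ∉ S).card =
            (T'.filter fun i => d i ∉ S).card + (T \ T').card := by
          rw [← Finset.card_union_of_disjoint]
          · congr 1
            ext i
            simp only [hT', Finset.mem_filter, Finset.mem_union, Finset.mem_sdiff]
            by_cases hi : d i = d i₀ <;> simp [hi, hmS]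
          · exact Finset.disjoint_of_subset_left (Finset.filter_subset _ _)
              Finset.disjoint_sdiff
        omega) rfl
  obtain ⟨X, hX⟩ := Submodule.exists_isCompl W'
  have hsup : W' ⊔ (X ⊓ W) = W := by
    rw [← sup_inf_assoc_of_le _ hWN, hX.sup_eq_top, top_inf_eq]
  have hXW : finrank K (X ⊓ W : Submodule K V) = Fintype.card (T \ T' : Finset ι) := by
    have h1 := Submodule.finrank_sup_add_finrank_inf_eq W' (X ⊓ W)
    have h2 : W' ⊓ (X ⊓ W) = ⊥ := by
      rw [← inf_assoc, hX.inf_eq_bot, bot_inf_eq]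
    rw [hsup, h2, finrank_bot] at h1
    rw [Fintype.card_coe]
    omega
  let c := (finBasisOfFinrankEq K (X ⊓ W : Submodule K V) hXW).reindex
    (Fintype.equivFin (T \ T' : Finset ι)).symm
  let b : ι → V := fun i => if h : i ∈ T \ T' then c ⟨i, h⟩ else b' i
  have hbT' : Set.EqOn b b' (T' : Set ι) := fun i hi => by
    have : i ∉ T \ T' := fun h => (Finset.mem_sdiff.1 h).2 hi
    simp only [b, dif_neg this]
  have hbc : Submodule.span K (b '' (T \ T' : Finset ι)) = X ⊓ W := by
    have h1 : b '' (T \ T' : Finset ι) = (X ⊓ W).subtype '' Set.range c := by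
      ext v
      constructor
      · rintro ⟨i, hi, rfl⟩
        refine ⟨c ⟨i, hi⟩, ⟨_, rfl⟩, ?_⟩
        simp only [b, dif_pos (Finset.mem_coe.1 hi)]
        rfl
      · rintro ⟨_, ⟨i, rfl⟩, rfl⟩
        refine ⟨i, i.2, ?_⟩
        simp only [b, dif_pos i.2]
        rfl
    rw [h1, Submodule.span_image, c.span_eq, Submodule.map_subtype_top]
  have hspanT' : Submodule.span K (b '' T') = W' := by rw [hbT'.image_eq, hb']
  refine ⟨b, ?_, fun j hj => ?_⟩
  · have h1 : (T : Set ι) = (T' : Set ι) ∪ ((T \ T' : Finset ι) : Set ι) := by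
      rw [← Finset.coe_union, Finset.union_sdiff_of_subset (Finset.filter_subset _ _)]
    rw [h1, Set.image_union, Submodule.span_union, hspanT', hbc, hsup]
  · by_cases hj' : j ∈ T'
    · have h1 := hAb' j hj'
      have h2 : b' '' {i | i ∈ T' ∧ d j < d i} = b '' {i | i ∈ T' ∧ d j < d i} :=
        ((hbT'.mono fun i hi => hi.1).image_eq).symm
      rw [h2] at h1
      rw [hbT' hj']
      exact Submodule.span_mono
        (Set.image_mono (fun i hi => ⟨(Finset.mem_filter.1 hi.1).1, hi.2⟩ :
          {i | i ∈ T' ∧ d j < d i} ⊆ {i | i ∈ T ∧ d j < d i})) h1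
    · have hdj : d j = d i₀ := by
        by_contra h
        exact hj' (Finset.mem_filter.2 ⟨hj, h⟩)
      have h1 : b j ∈ W := by
        have h2 : b j ∈ X ⊓ W := by
          rw [← hbc]
          exact Submodule.subset_span ⟨j, Finset.mem_coe.2 (Finset.mem_sdiff.2 ⟨hj, hj'⟩), rfl⟩
        exact h2.2
      have h2 : A (b j) ∈ Submodule.span K (b '' T') := by
        rw [hspanT']; exact hAW' ⟨_, h1, rfl⟩
      refine Submodule.span_mono (Set.image_mono fun i hi => ?_) h2
      have hi' := Finset.mem_filter.1 hi
      exact ⟨hi'.1, by rw [hdj]; exact lt_of_le_of_ne (hmin i hi'.1) (Ne.symm hi'.2)⟩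

end AdaptedBasis

/-! ### Similarity, determinantal rank criteria and block triangular matrices. -/

section MatrixForms

open Matrix Module

variable {ι F : Type*} [Fintype ι] [DecidableEq ι] [Field F]

theorem rank_pow_eq_finrank (A : Matrix ι ι F) (j : ℕ) :
    (A ^ j).rank = finrank F (LinearMap.range (toLin' A ^ j)) := by
  rw [← toLin'_pow]
  rfl

/-- Nilpotent matrices whose powers have the same ranks are similar. -/
theorem exists_similar_of_rank_pow_eq (A B : Matrix ι ι F) (h : ∀ j, (A ^ j).rank = (B ^ j).rank)
    (hA : ∃ N, (A ^ N).rank = 0) :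
    ∃ g : Matrix ι ι F, g.det ≠ 0 ∧ g * A = B * g := by
  obtain ⟨e, he⟩ := exists_equiv_of_finrank_range_pow_eq (toLin' A) (toLin' B)
    (fun j => by rw [← rank_pow_eq_finrank, ← rank_pow_eq_finrank, h])
    (by simpa only [rank_pow_eq_finrank] using hA)
  refine ⟨LinearMap.toMatrix' e.toLinearMap, ?_, ?_⟩
  · have h1 : LinearMap.toMatrix' e.toLinearMap * LinearMap.toMatrix' e.symm.toLinearMap = 1 := by
      rw [← LinearMap.toMatrix'_comp, LinearEquiv.comp_coe, LinearEquiv.symm_trans_self,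
        LinearEquiv.refl_toLinearMap, LinearMap.toMatrix'_id]
    exact left_ne_zero_of_mul (b := det (LinearMap.toMatrix' e.symm.toLinearMap))
      (by rw [← det_mul, h1, det_one]; exact one_ne_zero)
  · have h1 : e.toLinearMap ∘ₗ toLin' A = toLin' B ∘ₗ e.toLinearMap := LinearMap.ext he
    have h2 := congrArg LinearMap.toMatrix' h1
    rwa [LinearMap.toMatrix'_comp, LinearMap.toMatrix'_comp, LinearMap.toMatrix'_toLin',
      LinearMap.toMatrix'_toLin'] at h2

theorem exists_mul_mul_eq_one_of_lt_rank {A : Matrix ι ι F} {r : ℕ} (h : r < A.rank) :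
    ∃ (P : Matrix (Fin (r + 1)) ι F) (Q : Matrix ι (Fin (r + 1)) F), P * A * Q = 1 := by
  obtain ⟨V, U, e, -, -, hVU⟩ := exists_rank_normal_form A
  let f : Fin (r + 1) → ι := fun k => e.symm (Sum.inl (Fin.castLE h k))
  refine ⟨V.submatrix f id, U.submatrix id f, ?_⟩
  have h1 : V.submatrix f id * A * U.submatrix id f = (V * A * U).submatrix f f := rfl
  rw [h1, hVU]
  ext i j
  simp [f, one_apply]

/-- A form of the vanishing of minors. It makes rank bounds closed in the usual and the Zariski
topology, and compares ranks over ℝ and ℂ. -/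
theorem rank_le_iff_det_mul_mul_eq_zero {A : Matrix ι ι F} {r : ℕ} :
    A.rank ≤ r ↔ ∀ (P : Matrix (Fin (r + 1)) ι F) (Q : Matrix ι (Fin (r + 1)) F),
      (P * A * Q).det = 0 := by
  constructor
  · intro h P Q
    by_contra hdet
    have h1 := rank_of_det_ne_zero hdet
    have h2 := (rank_mul_le_left (P * A) Q).trans (rank_mul_le_right P A)
    rw [Fintype.card_fin] at h1
    omega
  · intro h
    by_contra hr
    obtain ⟨P, Q, hPQ⟩ := exists_mul_mul_eq_one_of_lt_rank (not_le.1 hr)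
    have h1 := h P Q
    rw [hPQ, det_one] at h1
    exact one_ne_zero h1

variable {α : Type*} [LinearOrder α]

/-- `z` is strictly block triangular for the blocks given by `d`. -/
def IsStrictBlock (d : ι → α) (z : Matrix ι ι F) : Prop := ∀ i j, z i j ≠ 0 → d j < d i

/-- The bounds on the ranks of the powers of `z` given by the sizes of the blocks of `d`. -/
def RankBound (d : ι → α) (z : Matrix ι ι F) : Prop :=
  ∀ S ⊆ Finset.univ.image d,
    (z ^ S.card).rank ≤ (Finset.univ.filter fun i => d i ∉ S).card

theorem RankBound.exists_rank_pow_eq_zero {d : ι → α} {z : Matrix ι ι F} (h : RankBound d z) :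
    ∃ N, (z ^ N).rank = 0 :=
  ⟨_, Nat.le_zero.1 ((h _ (Finset.Subset.refl _)).trans (by simp))⟩

/-- A matrix that satisfies the rank bounds is similar to a strictly block triangular one. -/
theorem RankBound.exists_isStrictBlock {d : ι → α} {z : Matrix ι ι F} (h : RankBound d z) :
    ∃ g w : Matrix ι ι F, g.det ≠ 0 ∧ IsStrictBlock d w ∧ z * g = g * w := by
  obtain ⟨b, hb, hzb⟩ := exists_adapted_family d (toLin' z) Finset.univ ⊤ le_top (by simp)
    (fun S hS => by
      rw [← LinearMap.range_eq_map, ← rank_pow_eq_finrank]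
      exact h S hS)
  rw [Finset.coe_univ, Set.image_univ] at hb
  have hlin : LinearIndependent F b :=
    linearIndependent_of_top_le_span_of_card_eq_finrank hb.ge (by simp)
  let B : Basis ι F (ι → F) := Basis.mk hlin hb.ge
  have hB : ⇑B = b := Basis.coe_mk _ _
  have hc : ∀ j i, B.repr (z *ᵥ b j) i ≠ 0 → d j < d i := by
    intro j i hij
    have h1 : z *ᵥ b j ∈ Submodule.span F (B '' {i | i ∈ Finset.univ ∧ d j < d i}) := by
      rw [hB]
      exact hzb j (Finset.mem_univ j)
    exact ((B.mem_span_image.1 h1) (Finsupp.mem_support_iff.2 hij)).2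
  refine ⟨of fun i j => b j i, of fun i j => B.repr (z *ᵥ b j) i, ?_, ?_, ?_⟩
  · rw [← isUnit_iff_ne_zero, ← isUnit_iff_isUnit_det, ← linearIndependent_cols_iff_isUnit]
    exact hlin
  · exact fun i j hij => hc j i hij
  · ext i j
    have h1 := congrFun (B.sum_repr (z *ᵥ b j)) i
    rw [Finset.sum_apply] at h1
    simp only [mul_apply, of_apply]
    refine h1.symm.trans (Finset.sum_congr rfl fun k _ => ?_)
    rw [hB, Pi.smul_apply, smul_eq_mul, mul_comm]

/-- A matrix that is block triangular with diagonal blocks that are themselves diagonal and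
invertible is invertible. -/
theorem det_ne_zero_of_block {d : ι → α} {M : Matrix ι ι F} (hd : ∀ i, M i i ≠ 0)
    (hM : ∀ i k, k ≠ i → M i k ≠ 0 → d k < d i) : M.det ≠ 0 := by
  classical
  intro hdet
  obtain ⟨v, hv, hMv⟩ := exists_mulVec_eq_zero_iff.2 hdet
  obtain ⟨i₁, hi₁⟩ := Function.ne_iff.1 hv
  -- At an index of the support of a kernel vector with least d, only the diagonal term of the row
  -- survives.
  obtain ⟨i, hi, hmin⟩ := (Finset.univ.filter fun i => v i ≠ 0).exists_min_image d
    ⟨i₁, by simpa using hi₁⟩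
  have h1 : (M *ᵥ v) i = M i i * v i := by
    refine Finset.sum_eq_single i (fun k _ hk => ?_) (by simp)
    by_contra h
    have h2 := hM i k hk (left_ne_zero_of_mul h)
    exact absurd (hmin k (by simpa using right_ne_zero_of_mul h)) (not_le.2 h2)
  rw [hMv] at h1
  exact mul_ne_zero (hd i) (by simpa using hi) h1.symm

/-- Adding a strictly block triangular matrix to a diagonal matrix that separates the blocks gives
a similar matrix. -/
theorem IsStrictBlock.diagonal_add_similar {d : ι → α} {z : Matrix ι ι F} (hz : IsStrictBlock d z)
    {δ : ι → F} (hδ : ∀ i j, d j < d i → δ i ≠ δ j) :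
    ∃ g : Matrix ι ι F, g.det ≠ 0 ∧ (diagonal δ + z) * g = g * diagonal δ := by
  have hzd : ∀ i, z i i = 0 := fun i => by
    by_contra h
    exact lt_irrefl _ (hz i i h)
  -- Column j of the conjugating matrix is an eigenvector of `diagonal δ + z` for δ j that agrees
  -- with the j-th standard vector at all i with d i ≤ d j.
  have hcol : ∀ j, ∃ y : ι → F, (∀ i, ¬ d j < d i → y i = if i = j then 1 else 0) ∧
      ∀ i, δ i * y i + ∑ k, z i k * y k = y i * δ j := by
    intro j
    -- The rows above block j impose the eigenvector equation, the others the normalization. The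
    -- remaining eigenvector equations then hold automatically by strict block triangularity.
    let N : Matrix ι ι F := of fun i k =>
      if d j < d i then (if i = k then δ i - δ j else 0) + z i k else if i = k then 1 else 0
    have hN : N.det ≠ 0 := by
      refine det_ne_zero_of_block (d := d) (fun i => ?_) (fun i k hk h => ?_)
      · by_cases h : d j < d i
        · simpa [N, h, hzd, sub_eq_zero] using hδ i j h
        · simp [N, h]
      · by_cases h' : d j < d i
        · exact hz i k (by simpa [N, h', hk.symm] using h)
        · simp [N, h', hk.symm] at h
    let v : ι → F := Pi.single j 1
    have hy : N *ᵥ (N⁻¹ *ᵥ v) = v := by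
      rw [mulVec_mulVec, mul_nonsing_inv _ (isUnit_iff_ne_zero.2 hN), one_mulVec]
    set y := N⁻¹ *ᵥ v
    have hy1 : ∀ i, ¬ d j < d i → y i = if i = j then 1 else 0 := by
      intro i hi
      have h1 := congrFun hy i
      simpa [mulVec, dotProduct, N, hi, v, Pi.single_apply] using h1
    refine ⟨y, hy1, fun i => ?_⟩
    by_cases hi : d j < d i
    · have h1 := congrFun hy i
      have h2 : i ≠ j := fun h => lt_irrefl _ (h ▸ hi)
      simp only [mulVec, dotProduct, N, hi, v, of_apply, if_true, add_mul, ite_mul, zero_mul,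
        Finset.sum_add_distrib, Finset.sum_ite_eq, Finset.mem_univ, Pi.single_apply, h2,
        if_false] at h1
      linear_combination h1
    · have h1 : ∑ k, z i k * y k = 0 := by
        refine Finset.sum_eq_zero fun k _ => ?_
        by_contra h
        have h2 := (hz i k (left_ne_zero_of_mul h)).trans_le (not_lt.1 hi)
        have h3 := hy1 k h2.le.not_gt
        rw [if_neg (fun hkj => lt_irrefl _ (hkj ▸ h2))] at h3
        exact right_ne_zero_of_mul h h3
      rw [h1, hy1 i hi]
      split_ifs with hij <;> simp [hij]
  choose y hy1 hy2 using hcol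
  refine ⟨of fun i j => y j i, ?_, ?_⟩
  · refine det_ne_zero_of_block (d := d) (fun i => ?_) (fun i k hk h => ?_)
    · simp [hy1 i i (lt_irrefl _)]
    · by_contra h'
      simp [hy1 k i h', hk.symm] at h
  · ext i j
    rw [add_mul, Matrix.add_apply, diagonal_mul, mul_diagonal]
    exact hy2 j i

-- The determinant is formed over the polynomial ring with the generic matrix in place of z.
open MvPolynomial in
theorem exists_mvPolynomial_eval_eq_det {r : ℕ} (P : Matrix (Fin r) ι F) (Q : Matrix ι (Fin r) F)
    (k : ℕ) : ∃ p : MvPolynomial (ι × ι) F, ∀ z : Matrix ι ι F,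
      eval (fun i => z i.1 i.2) p = (P * z ^ k * Q).det := by
  refine ⟨det ((P.map C : Matrix (Fin r) ι (MvPolynomial (ι × ι) F)) * mvPolynomialX ι ι F ^ k *
    (Q.map C : Matrix ι (Fin r) (MvPolynomial (ι × ι) F))), fun z => ?_⟩
  rw [RingHom.map_det, RingHom.mapMatrix_apply, Matrix.map_mul, Matrix.map_mul,
    ← RingHom.mapMatrix_apply (eval fun i : ι × ι => z i.1 i.2) (mvPolynomialX ι ι F ^ k), map_pow,
    mvPolynomialX_mapMatrix_eval, Matrix.map_map, Matrix.map_map]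
  congr 3
  · ext; simp
  · ext; simp

end MatrixForms

/-! ### Rank bounds for limits of shrinking diagonalizable matrices. -/

section RankBounds

open Matrix

variable {ι F : Type*} [Fintype ι] [DecidableEq ι] [Field F]

theorem pow_mul_eq_mul_pow {A B g : Matrix ι ι F} (h : A * g = g * B) (k : ℕ) :
    A ^ k * g = g * B ^ k :=
  ((show SemiconjBy g B A from h.symm).pow_right k).symm

theorem rank_eq_of_mul_eq_mul {A B g : Matrix ι ι F} (hg : g.det ≠ 0) (h : A * g = g * B) :
    A.rank = B.rank := by
  rw [← rank_mul_eq_left_of_isUnit_det g A (isUnit_iff_ne_zero.2 hg), h,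
    rank_mul_eq_right_of_isUnit_det g B (isUnit_iff_ne_zero.2 hg)]

theorem RankBound.of_mul_eq_mul {α : Type*} [LinearOrder α] {d : ι → α} {A B g : Matrix ι ι F}
    (hg : g.det ≠ 0) (h : A * g = g * B) (hB : RankBound d B) : RankBound d A := fun S hS => by
  rw [rank_eq_of_mul_eq_mul hg (pow_mul_eq_mul_pow h _)]
  exact hB S hS

theorem list_prod_sub_mul {y g : Matrix ι ι F} {δ : ι → F} (h : y * g = g * diagonal δ)
    (L : List F) : (L.map fun c => y - c • (1 : Matrix ι ι F)).prod * g =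
      g * diagonal fun i => (L.map fun c => δ i - c).prod := by
  induction L with
  | nil => simp
  | cons c L ih =>
    have h1 : (y - c • (1 : Matrix ι ι F)) * g = g * diagonal fun i => δ i - c := by
      rw [sub_mul, h, smul_mul_assoc, one_mul, ← diagonal_sub, mul_sub, ← smul_one_eq_diagonal,
        mul_smul_comm, mul_one]
    simp only [List.map_cons, List.prod_cons]
    rw [mul_assoc, ih, ← mul_assoc, h1, mul_assoc, diagonal_mul_diagonal]

/-- The product is conjugate to a diagonal matrix whose i-th entry has the factor νδ i − νδ i = 0
whenever δ i lies in S. -/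
theorem rank_list_prod_sub_le {y g : Matrix ι ι F} {δ : ι → F} {ν : F} (hg : g.det ≠ 0)
    (h : y * g = g * diagonal (ν • δ)) (S : Finset F) [DecidableEq F] :
    (S.toList.map fun s => y - (ν * s) • (1 : Matrix ι ι F)).prod.rank ≤
      (Finset.univ.filter fun i => δ i ∉ S).card := by
  have h1 := list_prod_sub_mul h (S.toList.map fun s => ν * s)
  rw [List.map_map] at h1
  have h2 := rank_eq_of_mul_eq_mul hg h1
  simp only [Function.comp_def] at h2
  rw [h2, rank_diagonal, Fintype.card_subtype]
  refine Finset.card_le_card fun i hi => ?_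
  rw [Finset.mem_filter] at hi ⊢
  refine ⟨hi.1, fun hiS => hi.2 ?_⟩
  refine List.prod_eq_zero ?_
  rw [List.map_map, List.mem_map]
  exact ⟨δ i, Finset.mem_toList.2 hiS, by simp⟩

/-- The blocks are ordered by real numbers while the eigenvalues live in F; the injection φ
translates between the two. -/
theorem rankBound_of_forall_finset [DecidableEq F] {d : ι → ℝ} {φ : ℝ → F}
    (hφ : Function.Injective φ) {z : Matrix ι ι F}
    (h : ∀ S : Finset F,
      (z ^ S.card).rank ≤ (Finset.univ.filter fun i => φ (d i) ∉ S).card) : RankBound d z := by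
  intro S _
  have h1 := h (S.image φ)
  rwa [Finset.card_image_of_injective _ hφ,
    Finset.filter_congr (q := fun i => d i ∉ S) fun i _ => by
      rw [hφ.mem_finset_image]] at h1

variable [TopologicalSpace F] [IsTopologicalRing F] [T1Space F]

theorem isClosed_rank_le (r : ℕ) : IsClosed {A : Matrix ι ι F | A.rank ≤ r} := by
  simp only [rank_le_iff_det_mul_mul_eq_zero, Set.ofPred_forall]
  refine isClosed_iInter fun P => isClosed_iInter fun Q => ?_
  have : Continuous fun A : Matrix ι ι F => (P * A * Q).det := by fun_prop
  exact isClosed_singleton.preimage this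

/-- The rank bounds hold for limits of matrices similar to `ν • diagonal δ` with `ν → 0`. -/
theorem rank_pow_le_of_mem_closure [DecidableEq F] {δ : ι → F} {z : Matrix ι ι F}
    (hz : ((0 : F), z) ∈ closure {p : F × Matrix ι ι F |
      ∃ g : Matrix ι ι F, g.det ≠ 0 ∧ p.2 * g = g * diagonal (p.1 • δ)}) (S : Finset F) :
    (z ^ S.card).rank ≤ (Finset.univ.filter fun i => δ i ∉ S).card := by
  -- Keeping ν as a coordinate makes the product jointly continuous, with value z^|S| at ν = 0.
  let f : F × Matrix ι ι F → Matrix ι ι F := fun p =>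
    (S.toList.map fun s => p.2 - (p.1 * s) • (1 : Matrix ι ι F)).prod
  have hf : Continuous f := by
    refine continuous_list_prod _ fun s _ => ?_
    exact continuous_snd.sub ((continuous_fst.mul continuous_const).smul continuous_const)
  have h1 : ((0 : F), z) ∈
      f ⁻¹' {A | A.rank ≤ (Finset.univ.filter fun i => δ i ∉ S).card} := by
    refine closure_minimal ?_ ((isClosed_rank_le _).preimage hf) hz
    rintro p ⟨g, hg, hp⟩
    exact rank_list_prod_sub_le hg hp S
  have h2 : f (0, z) = z ^ S.card := by simp [f]
  rw [Set.mem_preimage, h2] at h1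
  exact h1

/-- Strictly block triangular matrices satisfy the rank bounds. -/
theorem IsStrictBlock.rankBound {𝕜 : Type*} [RCLike 𝕜] {d : ι → ℝ} {w : Matrix ι ι 𝕜}
    (hw : IsStrictBlock d w) : RankBound d w := by
  classical
  refine rankBound_of_forall_finset (φ := fun r : ℝ => (r : 𝕜)) RCLike.ofReal_injective
    (rank_pow_le_of_mem_closure (δ := fun i => (d i : 𝕜)) ?_)
  set δ : ι → 𝕜 := fun i => (d i : 𝕜)
  -- w is the limit as ν → 0 of matrices which for ν ≠ 0 are similar to `diagonal (ν • δ)`.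
  have hc : Continuous fun ν : 𝕜 => (ν, diagonal (ν • δ) + w) := by fun_prop
  have h0 : Filter.Tendsto (fun ν : 𝕜 => (ν, diagonal (ν • δ) + w)) (nhdsWithin 0 {0}ᶜ)
      (nhds ((0 : 𝕜), w)) := by
    have h1 := (hc.tendsto 0).mono_left (nhdsWithin_le_nhds (s := {0}ᶜ))
    simpa using h1
  refine mem_closure_of_tendsto h0 ?_
  filter_upwards [self_mem_nhdsWithin] with ν hν
  refine hw.diagonal_add_similar fun i j hij h => ?_
  have h1 : ν * (d i : 𝕜) = ν * (d j : 𝕜) := h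
  exact hij.ne' (RCLike.ofReal_injective (mul_left_cancel₀ hν h1))

end RankBounds

/-! ### From similarity to conjugacy under the special linear group. -/

section Orbits

open Matrix

variable {n : ℕ} {F : Type*} [Field F]

theorem coe_Ad_mul (g : SpecialLinearGroup (Fin n) F) (z : sl (Fin n) F) :
    (Ad g z : Matrix (Fin n) (Fin n) F) * (g : Matrix (Fin n) (Fin n) F) = g * z := by
  have h : ((g⁻¹ : SpecialLinearGroup (Fin n) F) : Matrix (Fin n) (Fin n) F) *
      (g : Matrix (Fin n) (Fin n) F) = 1 :=
    congrArg Subtype.val (inv_mul_cancel g)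
  exact (mul_assoc _ _ _).trans ((congrArg _ h).trans (mul_one _))

theorem mem_orbit_iff {z w : sl (Fin n) F} :
    w ∈ orbit z ↔ ∃ g : Matrix (Fin n) (Fin n) F, g.det = 1 ∧
      (w : Matrix (Fin n) (Fin n) F) * g = g * z := by
  constructor
  · rintro ⟨g, rfl⟩
    exact ⟨g, g.2, coe_Ad_mul g z⟩
  · rintro ⟨g, hg, h⟩
    refine ⟨⟨g, hg⟩, Subtype.ext ?_⟩
    have h1 := (coe_Ad_mul ⟨g, hg⟩ z).trans h.symm
    have h2 : IsUnit g := by rw [isUnit_iff_isUnit_det, hg]; exact isUnit_one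
    exact (h2.mul_right_cancel h1).symm

/-- Over an algebraically closed field, an n-th root rescales g to determinant 1. -/
theorem mem_orbit_of_mul_eq_mul [IsAlgClosed F] {z w : sl (Fin n) F} {g : Matrix (Fin n) (Fin n) F}
    (hg : g.det ≠ 0) (h : (w : Matrix (Fin n) (Fin n) F) * g = g * z) : w ∈ orbit z := by
  rw [mem_orbit_iff]
  rcases Nat.eq_zero_or_pos n with rfl | hn
  · exact ⟨1, det_one, Subsingleton.elim _ _⟩
  obtain ⟨c, hc⟩ := IsAlgClosed.exists_pow_nat_eq (g.det)⁻¹ hn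
  refine ⟨c • g, ?_, ?_⟩
  · rw [det_smul, Fintype.card_fin, hc, inv_mul_cancel₀ hg]
  · rw [mul_smul_comm, h, smul_mul_assoc]

/-- Over ℝ the determinant may not be correctable by a scalar; instead a diagonal matrix t, which
commutes with `diagonal δ`, is inserted between g and h⁻¹. -/
theorem mem_orbit_of_diagonal {z w : sl (Fin n) F} {g h : Matrix (Fin n) (Fin n) F} {δ : Fin n → F}
    (hg : g.det ≠ 0) (hh : h.det ≠ 0) (hw : (w : Matrix (Fin n) (Fin n) F) * g = g * diagonal δ)
    (hz : (z : Matrix (Fin n) (Fin n) F) * h = h * diagonal δ) : w ∈ orbit z := by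
  rw [mem_orbit_iff]
  have hu : IsUnit h.det := isUnit_iff_ne_zero.2 hh
  obtain ⟨t, ht⟩ : ∃ t : Fin n → F, ∏ i, t i = h.det / g.det := by
    cases n with
    | zero => exact ⟨1, by simp⟩
    | succ n =>
      refine ⟨Pi.mulSingle 0 (h.det / g.det), ?_⟩
      rw [Finset.prod_pi_mulSingle']
      simp
  refine ⟨g * diagonal t * h⁻¹, ?_, ?_⟩
  · rw [det_mul, det_mul, det_diagonal, ht, det_nonsing_inv, Ring.inverse_eq_inv']
    field_simp
  · have hz' : h⁻¹ * (z : Matrix (Fin n) (Fin n) F) = diagonal δ * h⁻¹ := by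
      have h1 : (z : Matrix (Fin n) (Fin n) F) = h * diagonal δ * h⁻¹ := by
        rw [← hz, mul_assoc, mul_nonsing_inv _ hu, mul_one]
      rw [h1, ← mul_assoc, ← mul_assoc, nonsing_inv_mul _ hu, one_mul]
    have hc : diagonal δ * diagonal t = diagonal t * diagonal δ := by
      rw [diagonal_mul_diagonal, diagonal_mul_diagonal]
      congr 1; ext i; exact mul_comm _ _
    rw [mul_assoc _ h⁻¹, hz', ← mul_assoc, ← mul_assoc, hw, mul_assoc g, hc]
    simp only [mul_assoc]

end Orbits

/-! ### Real diagonalization of hyperbolic semisimple elements. -/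

section Diagonalization

open Matrix Module

variable {n : ℕ}

/-- The inclusion of `sl_n` into the space of all matrices, as a linear map. -/
def slInclusion (n : ℕ) (F : Type*) [Field F] : sl (Fin n) F →ₗ[F] Matrix (Fin n) (Fin n) F where
  toFun z := z
  map_add' _ _ := rfl
  map_smul' _ _ := rfl

theorem coe_ad_apply {F : Type*} [Field F] (x z : sl (Fin n) F) :
    (LieAlgebra.ad F (sl (Fin n) F) x z : Matrix (Fin n) (Fin n) F) =
      (x : Matrix (Fin n) (Fin n) F) * z - (z : Matrix (Fin n) (Fin n) F) * x := rfl

/-- The matrices that are eigenvectors of `ad x` span the space of all matrices. -/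
theorem IsHyperbolicSemisimple.eq_top {x : sl (Fin n) ℝ} (hx : IsHyperbolicSemisimple x)
    (P : Submodule ℝ (Matrix (Fin n) (Fin n) ℝ))
    (hP : ∀ (μ : ℝ) (z : Matrix (Fin n) (Fin n) ℝ),
      (x : Matrix (Fin n) (Fin n) ℝ) * z - z * x = μ • z → z ∈ P) : P = ⊤ := by
  rcases Nat.eq_zero_or_pos n with rfl | hn
  · exact Subsingleton.elim _ _
  rw [eq_top_iff]
  rintro z -
  have h1 : (⊤ : Submodule ℝ (sl (Fin n) ℝ)) ≤ P.comap (slInclusion n ℝ) := by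
    rw [← hx]
    refine iSup_le fun μ w hw => ?_
    refine hP μ w ?_
    rw [← coe_ad_apply, End.mem_eigenspace_iff.1 hw]
    rfl
  have hn' : (n : ℝ) ≠ 0 := by positivity
  have htr : trace (z - (trace z / n) • (1 : Matrix (Fin n) (Fin n) ℝ)) = 0 := by
    rw [trace_sub, trace_smul, trace_one, Fintype.card_fin, smul_eq_mul, div_mul_cancel₀ _ hn',
      sub_self]
  have h2 : z - (trace z / n) • (1 : Matrix (Fin n) (Fin n) ℝ) ∈ P :=
    h1 (x := ⟨_, LinearMap.mem_ker.2 htr⟩) trivial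
  have h3 : (1 : Matrix (Fin n) (Fin n) ℝ) ∈ P := hP 0 1 (by simp)
  have h4 := P.add_mem h2 (P.smul_mem (trace z / n) h3)
  rwa [sub_add_cancel] at h4

theorem exists_mulVec_eq {F : Type*} [Field F] {v : Fin n → F} (hv : v ≠ 0) (w : Fin n → F) :
    ∃ z : Matrix (Fin n) (Fin n) F, z *ᵥ v = w := by
  obtain ⟨i, hi⟩ := Function.ne_iff.1 hv
  refine ⟨vecMulVec w (Pi.single i (v i)⁻¹), ?_⟩
  rw [vecMulVec_mulVec]
  ext j
  simp [inv_mul_cancel₀ (show v i ≠ 0 from hi)]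

theorem mulVec_mulVec_of_commutator {F : Type*} [Field F] {x z : Matrix (Fin n) (Fin n) F}
    {v : Fin n → F} {l μ : F} (hv : x *ᵥ v = l • v) (hz : x * z - z * x = μ • z) :
    x *ᵥ (z *ᵥ v) = (l + μ) • (z *ᵥ v) := by
  rw [mulVec_mulVec, sub_eq_iff_eq_add.1 hz, add_mulVec, smul_mulVec, ← mulVec_mulVec, hv,
    mulVec_smul, add_smul, add_comm]

/-- An eigenmatrix of ad x with eigenvalue μ takes v into the eigenspace for l + μ. Such matrices
span all matrices, and all matrices applied to v ≠ 0 give the whole space. -/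
theorem IsHyperbolicSemisimple.iSup_eigenspace_complex {x : sl (Fin n) ℝ}
    (hx : IsHyperbolicSemisimple x) {v : Fin n → ℂ} (hv : v ≠ 0) {l : ℂ}
    (hl : (complexify x : Matrix (Fin n) (Fin n) ℂ) *ᵥ v = l • v) :
    ⨆ μ : ℝ, End.eigenspace (toLin' (complexify x : Matrix (Fin n) (Fin n) ℂ)) (l + μ) = ⊤ := by
  set U := ⨆ μ : ℝ, End.eigenspace (toLin' (complexify x : Matrix (Fin n) (Fin n) ℂ)) (l + μ)
  let f : Matrix (Fin n) (Fin n) ℝ →ₗ[ℝ] (Fin n → ℂ) :=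
    { toFun := fun z => z.map Complex.ofReal *ᵥ v
      map_add' := fun z w => by rw [Matrix.map_add _ Complex.ofReal_add, add_mulVec]
      map_smul' := fun c z => by
        ext i
        simp [mulVec, dotProduct, Finset.mul_sum, mul_assoc] }
  have h1 := hx.eq_top ((U.restrictScalars ℝ).comap f) (fun μ z hz => by
    have h2 : (complexify x : Matrix (Fin n) (Fin n) ℂ) * z.map Complex.ofReal -
        z.map Complex.ofReal * (complexify x : Matrix (Fin n) (Fin n) ℂ) =
          (μ : ℂ) • z.map Complex.ofReal := by
      have h3 := congrArg (fun w : Matrix (Fin n) (Fin n) ℝ => w.map Complex.ofRealHom) hz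
      simp only [Matrix.map_sub _ (map_sub Complex.ofRealHom), Matrix.map_mul] at h3
      refine h3.trans ?_
      ext i j
      simp
    exact Submodule.mem_iSup_of_mem (p := fun μ : ℝ => End.eigenspace
      (toLin' (complexify x : Matrix (Fin n) (Fin n) ℂ)) (l + μ)) μ
      (End.mem_eigenspace_iff.2 (mulVec_mulVec_of_commutator hl h2)))
  have h2 : ∀ z : Matrix (Fin n) (Fin n) ℝ, z.map Complex.ofReal *ᵥ v ∈ U := fun z => by
    have h3 : z ∈ (U.restrictScalars ℝ).comap f := by rw [h1]; trivial
    exact h3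
  rw [eq_top_iff]
  rintro w -
  obtain ⟨z, rfl⟩ := exists_mulVec_eq hv w
  have h3 : z = (z.map Complex.re).map Complex.ofReal +
      Complex.I • (z.map Complex.im).map Complex.ofReal := by
    ext i j
    simp [mul_comm Complex.I]
  rw [h3, add_mulVec, smul_mulVec]
  exact U.add_mem (h2 _) (U.smul_mem _ (h2 _))

/-- The conjugate of an eigenvalue l is again an eigenvalue, hence differs from l by a real number,
so l is real. The real or the imaginary part of an eigenvector then serves. -/
theorem IsHyperbolicSemisimple.exists_real_eigenvector {x : sl (Fin n) ℝ}
    (hx : IsHyperbolicSemisimple x) (hn : 0 < n) :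
    ∃ (v : Fin n → ℝ) (l : ℝ), v ≠ 0 ∧ (x : Matrix (Fin n) (Fin n) ℝ) *ᵥ v = l • v := by
  have : Nonempty (Fin n) := ⟨⟨0, hn⟩⟩
  set X := (complexify x : Matrix (Fin n) (Fin n) ℂ)
  have hXij : ∀ i j, X i j = ((x : Matrix (Fin n) (Fin n) ℝ) i j : ℂ) := fun i j => rfl
  obtain ⟨l, hl⟩ := End.exists_eigenvalue (toLin' X)
  obtain ⟨v, hv⟩ := hl.exists_hasEigenvector
  have hXv : X *ᵥ v = l • v := hv.apply_eq_smul
  have htop := hx.iSup_eigenspace_complex hv.2 hXv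
  have hconj : star v ∈ End.eigenspace (toLin' X) (star l) := by
    rw [End.mem_eigenspace_iff, toLin'_apply]
    ext i
    have h1 := congrArg star (congrFun hXv i)
    simpa [mulVec, dotProduct, hXij] using h1
  have hreal : ∃ μ : ℝ, l + μ = star l := by
    by_contra! hcon
    have h1 := (End.eigenspaces_iSupIndep (toLin' X)) (star l)
    have h2 : (⊤ : Submodule ℂ (Fin n → ℂ)) ≤
        ⨆ j, ⨆ (_ : j ≠ star l), End.eigenspace (toLin' X) j := by
      rw [← htop]
      exact iSup_le fun μ => le_iSup₂_of_le (l + μ) (hcon μ) le_rfl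
    rw [top_le_iff.1 h2, disjoint_top] at h1
    rw [h1, Submodule.mem_bot] at hconj
    exact hv.2 (star_eq_zero.1 hconj)
  obtain ⟨μ, hμ⟩ := hreal
  have him : l.im = 0 := by
    have h1 := congrArg Complex.im hμ
    simp at h1
    linarith
  have hre : (x : Matrix (Fin n) (Fin n) ℝ) *ᵥ (fun i => (v i).re) = l.re • fun i => (v i).re := by
    ext i
    have h1 := congrArg Complex.re (congrFun hXv i)
    simpa [mulVec, dotProduct, hXij, him] using h1
  have him' : (x : Matrix (Fin n) (Fin n) ℝ) *ᵥ (fun i => (v i).im) = l.re • fun i => (v i).im := by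
    ext i
    have h1 := congrArg Complex.im (congrFun hXv i)
    simpa [mulVec, dotProduct, hXij, him] using h1
  by_cases h : (fun i => (v i).re) = 0
  · refine ⟨_, _, fun h' => hv.2 ?_, him'⟩
    ext i
    exact Complex.ext (congrFun h i) (congrFun h' i)
  · exact ⟨_, _, h, hre⟩

/-- A hyperbolic semisimple element is diagonalizable over the reals. -/
theorem IsHyperbolicSemisimple.exists_diagonal {x : sl (Fin n) ℝ}
    (hx : IsHyperbolicSemisimple x) :
    ∃ (d : Fin n → ℝ) (h : Matrix (Fin n) (Fin n) ℝ), h.det ≠ 0 ∧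
      (x : Matrix (Fin n) (Fin n) ℝ) * h = h * diagonal d := by
  rcases Nat.eq_zero_or_pos n with rfl | hn
  · exact ⟨0, 1, by simp, Subsingleton.elim _ _⟩
  obtain ⟨v, l, hv, hl⟩ := hx.exists_real_eigenvector hn
  set X := (x : Matrix (Fin n) (Fin n) ℝ)
  let t : Set (Fin n → ℝ) := {w | ∃ μ : ℝ, X *ᵥ w = μ • w}
  let f : Matrix (Fin n) (Fin n) ℝ →ₗ[ℝ] (Fin n → ℝ) :=
    { toFun := fun z => z *ᵥ v
      map_add' := fun z w => add_mulVec _ _ _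
      map_smul' := fun c z => smul_mulVec _ _ _ }
  -- Eigenmatrices of ad x applied to the real eigenvector v are eigenvectors of x, and they span.
  have h1 := hx.eq_top ((Submodule.span ℝ t).comap f) fun μ z hz =>
    Submodule.subset_span ⟨l + μ, mulVec_mulVec_of_commutator hl hz⟩
  have hspan : Submodule.span ℝ t = ⊤ := by
    rw [eq_top_iff]
    rintro w -
    obtain ⟨z, rfl⟩ := exists_mulVec_eq hv w
    have h3 : z ∈ (Submodule.span ℝ t).comap f := by rw [h1]; trivial
    exact h3
  obtain ⟨b, hbt, hb, hli⟩ := exists_linearIndependent ℝ t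
  let B₀ : Basis b ℝ (Fin n → ℝ) := Basis.mk hli (by rw [Subtype.range_coe, hb, hspan])
  let B := B₀.reindex (B₀.indexEquiv (Pi.basisFun ℝ (Fin n)))
  have hB : ∀ i, ∃ μ : ℝ, X *ᵥ B i = μ • B i := fun i => by
    have h2 : B i ∈ b := by simp [B, B₀]
    exact hbt h2
  choose d hd using hB
  refine ⟨d, of fun i j => B j i, ?_, ?_⟩
  · rw [← isUnit_iff_ne_zero, ← isUnit_iff_isUnit_det, ← linearIndependent_cols_iff_isUnit]
    exact B.linearIndependent
  · ext i j
    rw [mul_diagonal]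
    have h2 := congrFun (hd j) i
    rw [Pi.smul_apply, smul_eq_mul, mul_comm] at h2
    exact h2

end Diagonalization

/-! ### The saturation of the nilradical and the limit of orbits as rank conditions. -/

section Saturation

open Matrix Module

variable {n : ℕ}

theorem trace_coe {F : Type*} [Field F] (z : sl (Fin n) F) :
    trace (z : Matrix (Fin n) (Fin n) F) = 0 := LinearMap.mem_ker.1 z.2

theorem trace_eq_of_mul_eq_mul {F : Type*} [Field F] {A B g : Matrix (Fin n) (Fin n) F}
    (hg : g.det ≠ 0) (h : A * g = g * B) : trace A = trace B := by
  have h1 : A = g * B * g⁻¹ := by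
    rw [← h, mul_assoc, mul_nonsing_inv _ (isUnit_iff_ne_zero.2 hg), mul_one]
  rw [h1, trace_mul_comm, ← mul_assoc, nonsing_inv_mul _ (isUnit_iff_ne_zero.2 hg), one_mul]

theorem IsStrictBlock.trace_eq_zero {F α : Type*} [Field F] [LinearOrder α] {d : Fin n → α}
    {w : Matrix (Fin n) (Fin n) F} (hw : IsStrictBlock d w) : trace w = 0 :=
  Finset.sum_eq_zero fun i _ => by
    by_contra h
    exact lt_irrefl _ (hw i i h)

theorem exists_mul_eq_mul {F : Type*} [Field F] {g : Matrix (Fin n) (Fin n) F} (hg : g.det ≠ 0)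
    {w : Matrix (Fin n) (Fin n) F} (hw : trace w = 0) :
    ∃ u : sl (Fin n) F, (u : Matrix (Fin n) (Fin n) F) * g = g * w := by
  have h1 : g * w * g⁻¹ * g = g * w := by
    rw [mul_assoc, nonsing_inv_mul _ (isUnit_iff_ne_zero.2 hg), mul_one]
  exact ⟨⟨g * w * g⁻¹, LinearMap.mem_ker.2 ((trace_eq_of_mul_eq_mul hg h1).trans hw)⟩, h1⟩

theorem coe_complexify (x : sl (Fin n) ℝ) :
    (complexify x : Matrix (Fin n) (Fin n) ℂ) =
      (x : Matrix (Fin n) (Fin n) ℝ).map Complex.ofRealHom := rfl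

theorem map_mul_map_eq {A B g : Matrix (Fin n) (Fin n) ℝ} (h : A * g = g * B) :
    A.map Complex.ofRealHom * g.map Complex.ofRealHom =
      g.map Complex.ofRealHom * B.map Complex.ofRealHom := by
  rw [← Matrix.map_mul, h, Matrix.map_mul]

theorem det_map_ne_zero {g : Matrix (Fin n) (Fin n) ℝ} (hg : g.det ≠ 0) :
    (g.map Complex.ofRealHom).det ≠ 0 := by
  rw [← RingHom.mapMatrix_apply, ← RingHom.map_det]
  exact Complex.ofReal_ne_zero.2 hg

theorem rank_le_rank_map (A : Matrix (Fin n) (Fin n) ℝ) :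
    A.rank ≤ (A.map Complex.ofRealHom).rank := by
  obtain ⟨r, hr⟩ : ∃ r, (A.map Complex.ofRealHom).rank = r := ⟨_, rfl⟩
  rw [hr, rank_le_iff_det_mul_mul_eq_zero]
  intro P Q
  have h1 := rank_le_iff_det_mul_mul_eq_zero.1 hr.le
    (P.map Complex.ofRealHom) (Q.map Complex.ofRealHom)
  rw [← Matrix.map_mul, ← Matrix.map_mul, ← RingHom.mapMatrix_apply, ← RingHom.map_det] at h1
  exact Complex.ofReal_eq_zero.1 h1

/-- In coordinates that diagonalize `x`, the space `u(x)` consists of the strictly block triangular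
matrices. -/
theorem mem_nilradical_iff {x : sl (Fin n) ℝ} {d : Fin n → ℝ} {h : Matrix (Fin n) (Fin n) ℂ}
    (hh : h.det ≠ 0)
    (hx : (complexify x : Matrix (Fin n) (Fin n) ℂ) * h = h * diagonal fun i => (d i : ℂ))
    {z : sl (Fin n) ℂ} {w : Matrix (Fin n) (Fin n) ℂ}
    (hz : (z : Matrix (Fin n) (Fin n) ℂ) * h = h * w) :
    z ∈ nilradical x ↔ IsStrictBlock d w := by
  have hu : IsUnit h.det := isUnit_iff_ne_zero.2 hh
  set X := (complexify x : Matrix (Fin n) (Fin n) ℂ)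
  have hw : w = h⁻¹ * (z : Matrix (Fin n) (Fin n) ℂ) * h := by
    rw [mul_assoc, hz, ← mul_assoc, nonsing_inv_mul _ hu, one_mul]
  constructor
  · intro hmem
    let N : Submodule ℂ (sl (Fin n) ℂ) :=
      { carrier := {y | IsStrictBlock d (h⁻¹ * (y : Matrix (Fin n) (Fin n) ℂ) * h)}
        zero_mem' := fun i j hij => by simp at hij
        add_mem' := fun {a b} ha hb i j hij => by
          have h1 : h⁻¹ * ((a + b : sl (Fin n) ℂ) : Matrix (Fin n) (Fin n) ℂ) * h =
              h⁻¹ * (a : Matrix (Fin n) (Fin n) ℂ) * h +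
                h⁻¹ * (b : Matrix (Fin n) (Fin n) ℂ) * h := by
            rw [← add_mul, ← mul_add]; rfl
          rw [h1] at hij
          by_contra hd
          apply hij
          rw [Matrix.add_apply, not_not.1 fun h0 => hd (ha i j h0),
            not_not.1 fun h0 => hd (hb i j h0), add_zero]
        smul_mem' := fun c a ha i j hij => by
          have h1 : h⁻¹ * ((c • a : sl (Fin n) ℂ) : Matrix (Fin n) (Fin n) ℂ) * h =
              c • (h⁻¹ * (a : Matrix (Fin n) (Fin n) ℂ) * h) := by
            rw [← smul_mul_assoc, ← mul_smul_comm]; rfl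
          rw [h1] at hij
          exact ha i j (right_ne_zero_of_mul hij) }
    have hle : nilradical x ≤ N := by
      refine iSup₂_le fun μ hμ y hy => ?_
      have hy1 : X * (y : Matrix (Fin n) (Fin n) ℂ) - y * X =
          (μ : ℂ) • (y : Matrix (Fin n) (Fin n) ℂ) := by
        rw [← coe_ad_apply, End.mem_eigenspace_iff.1 hy]
        rfl
      change IsStrictBlock d (h⁻¹ * (y : Matrix (Fin n) (Fin n) ℂ) * h)
      set v := h⁻¹ * (y : Matrix (Fin n) (Fin n) ℂ) * h with hv
      have hX' : h⁻¹ * X = (diagonal fun i => (d i : ℂ)) * h⁻¹ := by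
        have h2 : X = h * (diagonal fun i => (d i : ℂ)) * h⁻¹ := by
          rw [← hx, mul_assoc, mul_nonsing_inv _ hu, mul_one]
        rw [h2, ← mul_assoc, ← mul_assoc, nonsing_inv_mul _ hu, one_mul]
      have h3 : (diagonal fun i => (d i : ℂ)) * v - v * (diagonal fun i => (d i : ℂ)) =
          (μ : ℂ) • v := by
        rw [hv, ← smul_mul_assoc, ← mul_smul_comm, ← hy1, mul_sub, sub_mul, ← mul_assoc,
          ← mul_assoc, ← hX', mul_assoc _ h, ← hx]
        simp only [mul_assoc]
      intro i j hij
      have h4 := congrFun (congrFun h3 i) j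
      rw [Matrix.sub_apply, diagonal_mul, mul_diagonal, Matrix.smul_apply, smul_eq_mul,
        mul_comm (v i j), ← sub_mul] at h4
      have h5 := mul_right_cancel₀ hij h4
      have h6 : d i - d j = μ := by exact_mod_cast h5
      have h7 : 0 < μ := hμ
      linarith
    rw [hw]
    exact hle hmem
  · intro hs
    -- z is a sum of conjugated matrix units, and the one at (i, j) is an eigenvector of ad x with
    -- eigenvalue d i − d j > 0.
    have hmap : (z : Matrix (Fin n) (Fin n) ℂ) ∈ (nilradical x).map (slInclusion n ℂ) := by
      have h1 : (z : Matrix (Fin n) (Fin n) ℂ) =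
          ∑ i, ∑ j, h * Matrix.single i j (w i j) * h⁻¹ := by
        simp only [← Finset.sum_mul, ← Finset.mul_sum]
        rw [← matrix_eq_sum_single, ← hz, mul_assoc, mul_nonsing_inv _ hu, mul_one]
      rw [h1]
      refine Submodule.sum_mem _ fun i _ => Submodule.sum_mem _ fun j _ => ?_
      by_cases hij : w i j = 0
      · simp [hij]
      have hlt := hs i j hij
      have hne : i ≠ j := fun e => lt_irrefl _ (e ▸ hlt)
      obtain ⟨y, hy⟩ := exists_mul_eq_mul hh
        (w := Matrix.single i j (w i j)) (trace_single_eq_of_ne _ _ _ hne)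
      have hy' : (y : Matrix (Fin n) (Fin n) ℂ) = h * Matrix.single i j (w i j) * h⁻¹ := by
        rw [← hy, mul_assoc, mul_nonsing_inv _ hu, mul_one]
      refine ⟨y, ?_, hy'⟩
      refine Submodule.mem_iSup_of_mem (d i - d j) (Submodule.mem_iSup_of_mem
        (sub_pos.2 hlt) (End.mem_eigenspace_iff.2 (Subtype.ext ?_)))
      rw [coe_ad_apply]
      change X * (y : Matrix (Fin n) (Fin n) ℂ) - y * X =
        ((d i - d j : ℝ) : ℂ) • (y : Matrix (Fin n) (Fin n) ℂ)
      have hcancel : ∀ A B : Matrix (Fin n) (Fin n) ℂ, A * h = B * h → A = B := fun A B hAB => by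
        have h2 := congrArg (· * h⁻¹) hAB
        simpa only [mul_assoc, mul_nonsing_inv _ hu, mul_one] using h2
      apply hcancel
      rw [sub_mul, mul_assoc, hy, ← mul_assoc, hx, mul_assoc, mul_assoc _ X, hx, smul_mul_assoc, hy,
        ← mul_assoc (y : Matrix (Fin n) (Fin n) ℂ), hy, mul_assoc, ← mul_sub, ← mul_smul_comm]
      congr 1
      ext k l
      rw [Matrix.sub_apply, diagonal_mul, mul_diagonal, Matrix.smul_apply, smul_eq_mul,
        single_apply]
      split_ifs with hkl
      · obtain ⟨rfl, rfl⟩ := hkl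
        push_cast
        ring
      · simp
    obtain ⟨y, hy, hyz⟩ := hmap
    have : y = z := Subtype.ext hyz
    exact this ▸ hy

/-- The set `G · u(x)` is described by the rank bounds. -/
theorem saturation_nilradical_eq {x : sl (Fin n) ℝ} {d : Fin n → ℝ}
    {h : Matrix (Fin n) (Fin n) ℂ} (hh : h.det ≠ 0)
    (hx : (complexify x : Matrix (Fin n) (Fin n) ℂ) * h = h * diagonal fun i => (d i : ℂ)) :
    saturation (nilradical x : Set (sl (Fin n) ℂ)) =
      {z : sl (Fin n) ℂ | RankBound d (z : Matrix (Fin n) (Fin n) ℂ)} := by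
  have hu : IsUnit h.det := isUnit_iff_ne_zero.2 hh
  ext z
  constructor
  · rintro ⟨u, hu', hz⟩
    obtain ⟨g, hg, hz⟩ := mem_orbit_iff.1 hz
    have h1 : (u : Matrix (Fin n) (Fin n) ℂ) * h = 
        h * (h⁻¹ * (u : Matrix (Fin n) (Fin n) ℂ) * h) := by
      rw [← mul_assoc, ← mul_assoc, mul_nonsing_inv _ hu, one_mul]
    have h2 := (mem_nilradical_iff hh hx h1).1 hu'
    exact (h2.rankBound.of_mul_eq_mul hh h1).of_mul_eq_mul (by rw [hg]; exact one_ne_zero) hz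
  · intro hz
    obtain ⟨g, w, hg, hw, hzg⟩ := RankBound.exists_isStrictBlock hz
    obtain ⟨u, hu'⟩ := exists_mul_eq_mul hh hw.trace_eq_zero
    refine ⟨u, (mem_nilradical_iff hh hx hu').2 hw,
      mem_orbit_of_mul_eq_mul (g := g * h⁻¹) ?_ ?_⟩
    · rw [det_mul]
      exact mul_ne_zero hg (by rw [det_nonsing_inv, Ring.inverse_eq_inv']; exact inv_ne_zero hh)
    · have h2 : w * h⁻¹ = h⁻¹ * (u : Matrix (Fin n) (Fin n) ℂ) := by
        have h3 : w = h⁻¹ * (u : Matrix (Fin n) (Fin n) ℂ) * h := by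
          rw [mul_assoc, hu', ← mul_assoc, nonsing_inv_mul _ hu, one_mul]
        rw [h3, mul_assoc, mul_nonsing_inv _ hu, mul_one]
      rw [← mul_assoc, hzg, mul_assoc, h2, mul_assoc]

/-- The limit of orbits is described by the rank bounds. -/
theorem orbitLimit_eq {x : sl (Fin n) ℝ} {d : Fin n → ℝ} {h : Matrix (Fin n) (Fin n) ℝ}
    (hh : h.det ≠ 0) (hx : (x : Matrix (Fin n) (Fin n) ℝ) * h = h * diagonal d) :
    orbitLimit x = {z : sl (Fin n) ℝ | RankBound d (z : Matrix (Fin n) (Fin n) ℝ)} := by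
  have hνx : ∀ ν : ℝ, ((ν • x : sl (Fin n) ℝ) : Matrix (Fin n) (Fin n) ℝ) * h =
      h * diagonal (ν • d) := fun ν => by
    change (ν • (x : Matrix (Fin n) (Fin n) ℝ)) * h = _
    rw [smul_mul_assoc, hx, diagonal_smul, mul_smul_comm]
  ext z
  simp only [orbitLimit, Set.mem_iInter]
  constructor
  · intro hz
    refine rankBound_of_forall_finset (φ := id) Function.injective_id
      (rank_pow_le_of_mem_closure (δ := d) ?_)
    rw [mem_closure_iff_nhds]
    intro t ht
    rw [nhds_prod_eq, Filter.mem_prod_iff] at ht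
    obtain ⟨t₁, ht₁, t₂, ht₂, hsub⟩ := ht
    obtain ⟨ε, hε, hball⟩ := Metric.mem_nhds_iff.1 ht₁
    have ht₂' : (fun y : sl (Fin n) ℝ => (y : Matrix (Fin n) (Fin n) ℝ)) ⁻¹' t₂ ∈ nhds z :=
      continuous_subtype_val.continuousAt.preimage_mem_nhds ht₂
    obtain ⟨y, hyt, hy⟩ := mem_closure_iff_nhds.1 (hz ε hε) _ ht₂'
    simp only [Set.mem_iUnion] at hy
    obtain ⟨ν, hν, hy⟩ := hy
    obtain ⟨g, hg, hy⟩ := mem_orbit_iff.1 hy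
    refine ⟨(ν, y), hsub ⟨hball ?_, hyt⟩, g * h, ?_, ?_⟩
    · rw [Metric.mem_ball, Real.dist_eq, sub_zero, abs_of_pos hν.1]
      exact hν.2
    · rw [det_mul, hg, one_mul]
      exact hh
    · change (y : Matrix (Fin n) (Fin n) ℝ) * (g * h) = g * h * diagonal (ν • d)
      rw [← mul_assoc, hy, mul_assoc, hνx, mul_assoc]
  · intro hz ε hε
    obtain ⟨g, w, hg, hw, hzg⟩ := RankBound.exists_isStrictBlock hz
    -- c is g diag(d) g⁻¹, so z + νc = g (ν diag(d) + w) g⁻¹ is conjugate to νx for ν > 0 and tends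
    -- to z.
    obtain ⟨c, hc⟩ := exists_mul_eq_mul hg
      ((trace_eq_of_mul_eq_mul hh hx).symm.trans (trace_coe x))
    have hcont : Continuous fun ν : ℝ => z + ν • c := by
      refine Continuous.subtype_mk (f := fun ν : ℝ => (z : Matrix (Fin n) (Fin n) ℝ) +
        ν • (c : Matrix (Fin n) (Fin n) ℝ)) (by fun_prop) _
    have ht : Filter.Tendsto (fun ν : ℝ => z + ν • c) (nhdsWithin 0 (Set.Ioi 0)) (nhds z) := by
      have h1 := (hcont.tendsto 0).mono_left (nhdsWithin_le_nhds (s := Set.Ioi 0))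
      simpa using h1
    refine mem_closure_of_tendsto ht ?_
    filter_upwards [Ioo_mem_nhdsGT (show (0 : ℝ) < ε from hε)] with ν hν
    refine Set.mem_iUnion₂.2 ⟨ν, hν, ?_⟩
    obtain ⟨k, hk, hdk⟩ := hw.diagonal_add_similar (δ := ν • d)
      (fun i j hij => (mul_lt_mul_of_pos_left hij hν.1).ne')
    refine mem_orbit_of_diagonal (g := g * k) (by rw [det_mul]; exact mul_ne_zero hg hk) hh ?_
      (hνx ν)
    change ((z : Matrix (Fin n) (Fin n) ℝ) + ν • (c : Matrix (Fin n) (Fin n) ℝ)) * (g * k) = _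
    rw [← mul_assoc, add_mul, hzg, smul_mul_assoc, hc, ← mul_smul_comm, ← mul_add, mul_assoc g k,
      ← hdk, mul_assoc, diagonal_smul, add_comm w]

/-- Passing to ℂ goes through the real strictly block triangular form, so that only the inequality
`rank_le_rank_map` is needed for the way back. -/
theorem rankBound_complexify_iff {d : Fin n → ℝ} {z : sl (Fin n) ℝ} :
    RankBound d (complexify z : Matrix (Fin n) (Fin n) ℂ) ↔
      RankBound d (z : Matrix (Fin n) (Fin n) ℝ) := by
  constructor
  · intro hz S hS
    refine (rank_le_rank_map _).trans ?_
    have h1 := hz S hS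
    rwa [coe_complexify, ← RingHom.mapMatrix_apply, ← map_pow] at h1
  · intro hz
    obtain ⟨g, w, hg, hw, hzg⟩ := hz.exists_isStrictBlock
    refine RankBound.of_mul_eq_mul (det_map_ne_zero hg) (map_mul_map_eq hzg)
      (IsStrictBlock.rankBound fun i j hij => hw i j fun h0 => hij ?_)
    rw [map_apply, h0, map_zero]

end Saturation

/-! ### Irreducibility of linear spaces, by restriction to lines. -/

section PolynomialOnLines

open Polynomial

variable {F E : Type*} [Field F] [AddCommGroup E] [Module F E]

/-- The restriction of `f` to every affine line is a polynomial function. -/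
def IsPolynomialOnLines (f : E → F) : Prop :=
  ∀ a b : E, ∃ p : F[X], ∀ t : F, f (a + t • b) = p.eval t

/-- On the line joining two points where f and g respectively do not vanish, both are nonzero
polynomials, and so is their product. -/
theorem IsPolynomialOnLines.exists_mul_ne_zero [Infinite F] {f g : E → F}
    (hf : IsPolynomialOnLines f) (hg : IsPolynomialOnLines g) (W : Submodule F E)
    (hfW : ∃ a ∈ W, f a ≠ 0) (hgW : ∃ a ∈ W, g a ≠ 0) : ∃ a ∈ W, f a * g a ≠ 0 := by
  obtain ⟨a, ha, hfa⟩ := hfW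
  obtain ⟨b, hb, hgb⟩ := hgW
  obtain ⟨p, hp⟩ := hf a (b - a)
  obtain ⟨q, hq⟩ := hg a (b - a)
  have hp0 : p ≠ 0 := fun h => hfa (by simpa [h] using hp 0)
  have hq0 : q ≠ 0 := fun h => hgb (by simpa [h] using hq 1)
  by_contra! hcon
  refine mul_ne_zero hp0 hq0 (Polynomial.funext fun t => ?_)
  rw [eval_mul, ← hp, ← hq, eval_zero]
  exact hcon _ (W.add_mem ha (W.smul_mem t (W.sub_mem hb ha)))

theorem isPolynomialOnLines_eval {σ : Type*} (L : E →ₗ[F] σ → F) (p : MvPolynomial σ F) :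
    IsPolynomialOnLines fun z => MvPolynomial.eval (L z) p := by
  intro a b
  refine ⟨MvPolynomial.aeval (fun i => C (L a i) + X * C (L b i)) p, fun t => ?_⟩
  induction p using MvPolynomial.induction_on with
  | C c => simp
  | add p q hp hq => simp only [map_add, eval_add] at hp hq ⊢; rw [hp, hq]
  | mul_X p i hp =>
    simp only [map_mul, eval_mul, MvPolynomial.eval_X, MvPolynomial.aeval_X] at hp ⊢
    rw [hp]
    simp only [map_add, map_smul, Pi.add_apply, Pi.smul_apply, smul_eq_mul, eval_add, eval_mul,
      eval_C, eval_X]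

theorem exists_eval_prod_ne_zero [Infinite F] {σ κ : Type*} (L : E →ₗ[F] σ → F) (W : Submodule F E)
    (s : Finset κ) (p : κ → MvPolynomial σ F)
    (hp : ∀ j ∈ s, ∃ a ∈ W, MvPolynomial.eval (L a) (p j) ≠ 0) :
    ∃ a ∈ W, MvPolynomial.eval (L a) (∏ j ∈ s, p j) ≠ 0 := by
  classical
  induction s using Finset.induction_on with
  | empty => exact ⟨0, W.zero_mem, by simp⟩
  | insert j s hj ih =>
    simp only [Finset.prod_insert hj, map_mul]
    exact (isPolynomialOnLines_eval L _).exists_mul_ne_zero (isPolynomialOnLines_eval L _) W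
      (hp j (Finset.mem_insert_self _ _)) (ih fun k hk => hp k (Finset.mem_insert_of_mem hk))

end PolynomialOnLines

/-! ### The generic orbit in the nilradical and its Zariski closure. -/

section Richardson

open Matrix

variable {n : ℕ}

/-- The entries of an element of `sl_n`, as a linear map. -/
def slEntries (n : ℕ) (F : Type*) [Field F] : sl (Fin n) F →ₗ[F] Fin n × Fin n → F where
  toFun z i := (z : Matrix (Fin n) (Fin n) F) i.1 i.2
  map_add' _ _ := rfl
  map_smul' _ _ := rfl

/-- The adjoint action as a linear map. -/
def adLinear {F : Type*} [Field F] (g : SpecialLinearGroup (Fin n) F) :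
    sl (Fin n) F →ₗ[F] sl (Fin n) F where
  toFun := Ad g
  map_add' a b := Subtype.ext <| (congrArg (· * _) (mul_add (g : Matrix (Fin n) (Fin n) F)
    (a : Matrix (Fin n) (Fin n) F) (b : Matrix (Fin n) (Fin n) F))).trans (add_mul _ _ _)
  map_smul' c a := Subtype.ext <| (congrArg (· * _) (mul_smul_comm c
    (g : Matrix (Fin n) (Fin n) F) (a : Matrix (Fin n) (Fin n) F))).trans (smul_mul_assoc _ _ _)

theorem orbit_subset_orbit {F : Type*} [Field F] {z w : sl (Fin n) F} (h : w ∈ orbit z) :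
    orbit w ⊆ orbit z := by
  intro y hy
  rw [mem_orbit_iff] at h hy ⊢
  obtain ⟨g, hg, h⟩ := h
  obtain ⟨k, hk, hy⟩ := hy
  exact ⟨k * g, by rw [det_mul, hg, hk, one_mul], by rw [← mul_assoc, hy, mul_assoc, h, mul_assoc]⟩

theorem self_mem_orbit {F : Type*} [Field F] (z : sl (Fin n) F) : z ∈ orbit z :=
  mem_orbit_iff.2 ⟨1, det_one, by rw [mul_one, one_mul]⟩

theorem mem_orbit_symm {F : Type*} [Field F] {z w : sl (Fin n) F} (h : w ∈ orbit z) :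
    z ∈ orbit w := by
  obtain ⟨g, hg, h⟩ := mem_orbit_iff.1 h
  have hu : IsUnit g.det := by rw [hg]; exact isUnit_one
  refine mem_orbit_iff.2 ⟨g⁻¹, by rw [det_nonsing_inv, hg, Ring.inverse_one], ?_⟩
  have h1 : (w : Matrix (Fin n) (Fin n) F) = g * (z : Matrix (Fin n) (Fin n) F) * g⁻¹ := by
    rw [← h, mul_assoc, mul_nonsing_inv _ hu, mul_one]
  rw [h1, ← mul_assoc, ← mul_assoc, nonsing_inv_mul _ hu, one_mul]

theorem rank_pow_eq_of_mem_orbit {F : Type*} [Field F] {z w : sl (Fin n) F} (h : w ∈ orbit z)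
    (k : ℕ) : ((w : Matrix (Fin n) (Fin n) F) ^ k).rank =
      ((z : Matrix (Fin n) (Fin n) F) ^ k).rank := by
  obtain ⟨g, hg, h⟩ := mem_orbit_iff.1 h
  exact rank_eq_of_mul_eq_mul (by rw [hg]; exact one_ne_zero) (pow_mul_eq_mul_pow h k)

/-- Upper bounds for the ranks of powers pass to the Zariski closure. -/
theorem rank_pow_le_of_mem_zariskiClosure {F : Type*} [Field F] {S : Set (sl (Fin n) F)} {k r : ℕ}
    (hS : ∀ w ∈ S, ((w : Matrix (Fin n) (Fin n) F) ^ k).rank ≤ r) {z : sl (Fin n) F}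
    (hz : z ∈ zariskiClosure S) : ((z : Matrix (Fin n) (Fin n) F) ^ k).rank ≤ r := by
  rw [rank_le_iff_det_mul_mul_eq_zero]
  intro P Q
  obtain ⟨p, hp⟩ := exists_mvPolynomial_eval_eq_det P Q k
  rw [← hp]
  refine hz p fun w hw => ?_
  rw [hp]
  exact rank_le_iff_det_mul_mul_eq_zero.1 (hS w hw) P Q

/-- Rank is lower semicontinuous: a determinant witnessing the rank of A^k stays nonzero on a
Zariski open set. -/
theorem exists_mvPolynomial_rank_le {F : Type*} [Field F] (A : Matrix (Fin n) (Fin n) F) (k : ℕ) :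
    ∃ p : MvPolynomial (Fin n × Fin n) F, MvPolynomial.eval (fun i => A i.1 i.2) p ≠ 0 ∧
      ∀ z : Matrix (Fin n) (Fin n) F, MvPolynomial.eval (fun i => z i.1 i.2) p ≠ 0 →
        (A ^ k).rank ≤ (z ^ k).rank := by
  rcases hr : (A ^ k).rank with _ | r
  · exact ⟨1, by simp, fun _ _ => Nat.zero_le _⟩
  obtain ⟨P, Q, hPQ⟩ := exists_mul_mul_eq_one_of_lt_rank (A := A ^ k) (r := r) (by omega)
  obtain ⟨p, hp⟩ := exists_mvPolynomial_eval_eq_det P Q k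
  refine ⟨p, by rw [hp, hPQ, det_one]; exact one_ne_zero, fun z hz => ?_⟩
  rw [hp] at hz
  by_contra h
  exact hz (rank_le_iff_det_mul_mul_eq_zero.1 (by omega) P Q)

theorem RankBound.rank_pow_eq_zero {F : Type*} [Field F] {d : Fin n → ℝ}
    {z : Matrix (Fin n) (Fin n) F} (h : RankBound d z) {j : ℕ}
    (hj : (Finset.univ.image d).card ≤ j) : (z ^ j).rank = 0 := by
  have h1 := h _ (Finset.Subset.refl _)
  rw [← Nat.add_sub_of_le hj, pow_add]
  have h2 := rank_mul_le_left (z ^ (Finset.univ.image d).card)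
    (z ^ (j - (Finset.univ.image d).card))
  have h3 : (Finset.univ.filter fun i => d i ∉ Finset.univ.image d).card = 0 := by simp
  omega

theorem exists_max_rank_pow {F : Type*} [Field F] (W : Submodule F (sl (Fin n) F)) (k : ℕ) :
    ∃ a ∈ W, ∀ z ∈ W, ((z : Matrix (Fin n) (Fin n) F) ^ k).rank ≤
      ((a : Matrix (Fin n) (Fin n) F) ^ k).rank := by
  let T : Set ℕ := (fun z : sl (Fin n) F => ((z : Matrix (Fin n) (Fin n) F) ^ k).rank) '' W
  have hb : BddAbove T := ⟨n, by
    rintro _ ⟨z, -, rfl⟩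
    exact rank_le_width _⟩
  obtain ⟨a, ha, hmax⟩ := Nat.sSup_mem (s := T) ⟨_, 0, W.zero_mem, rfl⟩ hb
  refine ⟨a, ha, fun z hz => ?_⟩
  have h1 := le_csSup hb (⟨z, hz, rfl⟩ : ((z : Matrix (Fin n) (Fin n) F) ^ k).rank ∈ T)
  rwa [← hmax] at h1

theorem mem_orbit_of_rank_pow_eq {F : Type*} [Field F] [IsAlgClosed F] {d : Fin n → ℝ}
    {z w : sl (Fin n) F} (hz : RankBound d (z : Matrix (Fin n) (Fin n) F))
    (h : ∀ j, ((z : Matrix (Fin n) (Fin n) F) ^ j).rank =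
      ((w : Matrix (Fin n) (Fin n) F) ^ j).rank) : w ∈ orbit z := by
  obtain ⟨g, hg, hgz⟩ := exists_similar_of_rank_pow_eq (z : Matrix (Fin n) (Fin n) F)
    (w : Matrix (Fin n) (Fin n) F) h hz.exists_rank_pow_eq_zero
  exact mem_orbit_of_mul_eq_mul hg hgz.symm

/-- In a linear space of matrices that satisfy the rank bounds, a nonempty Zariski open subset
lies in a single orbit. -/
theorem exists_generic_orbit {F : Type*} [Field F] [IsAlgClosed F] {d : Fin n → ℝ}
    {W : Submodule F (sl (Fin n) F)} (hW : ∀ z ∈ W, RankBound d (z : Matrix (Fin n) (Fin n) F)) :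
    ∃ e ∈ W, ∃ p : MvPolynomial (Fin n × Fin n) F,
      MvPolynomial.eval (slEntries n F e) p ≠ 0 ∧
        ∀ z ∈ W, MvPolynomial.eval (slEntries n F z) p ≠ 0 → z ∈ orbit e := by
  choose a ha hmax using exists_max_rank_pow W
  choose p hp hple using fun k => exists_mvPolynomial_rank_le (a k : Matrix (Fin n) (Fin n) F) k
  have : Infinite F := IsAlgClosed.instInfinite
  -- All powers from the N-th on vanish on W, so a finite product of polynomials controls every
  -- rank.
  set N := (Finset.univ.image d).card
  obtain ⟨e, heW, he⟩ := exists_eval_prod_ne_zero (slEntries n F) W (Finset.range N) p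
    fun j _ => ⟨a j, ha j, hp j⟩
  have key : ∀ z ∈ W, MvPolynomial.eval (slEntries n F z) (∏ j ∈ Finset.range N, p j) ≠ 0 →
      ∀ j, ((z : Matrix (Fin n) (Fin n) F) ^ j).rank =
        ((a j : Matrix (Fin n) (Fin n) F) ^ j).rank := by
    intro z hz hne j
    rcases lt_or_ge j N with hj | hj
    · rw [map_prod, Finset.prod_ne_zero_iff] at hne
      exact le_antisymm (hmax j z hz) (hple j z (hne j (Finset.mem_range.2 hj)))
    · rw [(hW z hz).rank_pow_eq_zero hj, (hW _ (ha j)).rank_pow_eq_zero hj]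
  refine ⟨e, heW, _, he, fun z hz hne => mem_orbit_of_rank_pow_eq (hW e heW) fun j => ?_⟩
  rw [key e heW he, key z hz hne]

/-- If f vanishes on the orbit of e but f ∘ Ad g does not vanish on W, then f ∘ Ad g and p are both
nonzero at some c in W. This c lies in the orbit of e, and so does Ad g c, a contradiction. -/
theorem saturation_subset_zariskiClosure {F : Type*} [Field F] [Infinite F]
    {W : Submodule F (sl (Fin n) F)} {e : sl (Fin n) F} (he : e ∈ W)
    {p : MvPolynomial (Fin n × Fin n) F} (hp : MvPolynomial.eval (slEntries n F e) p ≠ 0)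
    (hW : ∀ z ∈ W, MvPolynomial.eval (slEntries n F z) p ≠ 0 → z ∈ orbit e) :
    saturation (W : Set (sl (Fin n) F)) ⊆ zariskiClosure (orbit e) := by
  rintro _ ⟨z, hz, g, rfl⟩ f hf
  by_contra hne
  obtain ⟨c, hc, hc'⟩ := (isPolynomialOnLines_eval (slEntries n F ∘ₗ adLinear g) f
    ).exists_mul_ne_zero (isPolynomialOnLines_eval (slEntries n F) p) W ⟨z, hz, hne⟩ ⟨e, he, hp⟩
  have h1 := hW c hc (right_ne_zero_of_mul hc')
  exact left_ne_zero_of_mul hc' (hf (Ad g c) (orbit_subset_orbit h1 ⟨g, rfl⟩))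

end Richardson

end AdjointLimit

/-! ### The main theorem. -/

open AdjointLimit in
theorem corollary5p3 (n : ℕ) (x : sl (Fin n) ℝ) (hx : AdjointLimit.IsHyperbolicSemisimple x) :
    (∃ e : sl (Fin n) ℂ, AdjointLimit.richardsonOrbit x = AdjointLimit.orbit e) ∧
    AdjointLimit.complexify '' AdjointLimit.orbitLimit x =
      AdjointLimit.saturation (AdjointLimit.nilradical x : Set (sl (Fin n) ℂ)) ∩
        AdjointLimit.realForm n ∧
    AdjointLimit.saturation (AdjointLimit.nilradical x : Set (sl (Fin n) ℂ)) ∩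
        AdjointLimit.realForm n =
      AdjointLimit.zariskiClosure (AdjointLimit.richardsonOrbit x) ∩
        AdjointLimit.realForm n := by
  obtain ⟨d, h, hh, hxh⟩ := hx.exists_diagonal
  have hxc : (complexify x : Matrix (Fin n) (Fin n) ℂ) * h.map Complex.ofRealHom =
      h.map Complex.ofRealHom * Matrix.diagonal fun i => (d i : ℂ) := by
    rw [coe_complexify, map_mul_map_eq hxh, Matrix.diagonal_map (map_zero _)]
    rfl
  have hsat := saturation_nilradical_eq (det_map_ne_zero hh) hxc
  have hW : ∀ z ∈ nilradical x, RankBound d (z : Matrix (Fin n) (Fin n) ℂ) := fun z hz => by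
    have h1 : z ∈ saturation (nilradical x : Set (sl (Fin n) ℂ)) := ⟨z, hz, self_mem_orbit z⟩
    rwa [hsat] at h1
  obtain ⟨e, he, p, hp, hpW⟩ := exists_generic_orbit hW
  have hdense := saturation_subset_zariskiClosure he hp hpW
  have hrich : richardsonOrbit x = orbit e := by
    ext z
    constructor
    · rintro ⟨hz, hzd⟩
      -- The orbits of z and e lie in each other's closures, so the ranks of their powers bound each
      -- other.
      refine mem_orbit_of_rank_pow_eq (hW e he) fun j => le_antisymm ?_ ?_
      · exact rank_pow_le_of_mem_zariskiClosure
          (fun w hw => (rank_pow_eq_of_mem_orbit hw j).le) (hzd ⟨e, he, self_mem_orbit e⟩)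
      · exact rank_pow_le_of_mem_zariskiClosure
          (fun w hw => (rank_pow_eq_of_mem_orbit hw j).le) (hdense hz)
    · intro hz
      refine ⟨⟨e, he, hz⟩, ?_⟩
      rwa [(orbit_subset_orbit hz).antisymm (orbit_subset_orbit (mem_orbit_symm hz))]
  have hclosure : zariskiClosure (orbit e) =
      saturation (nilradical x : Set (sl (Fin n) ℂ)) := by
    refine Set.Subset.antisymm (fun z hz => ?_) hdense
    rw [hsat]
    exact fun S hS => rank_pow_le_of_mem_zariskiClosure
      (fun w hw => (rank_pow_eq_of_mem_orbit hw _).trans_le (hW e he S hS)) hz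
  refine ⟨⟨e, hrich⟩, ?_, by rw [hrich, hclosure]⟩
  rw [hsat, orbitLimit_eq hh hxh]
  ext z
  constructor
  · rintro ⟨y, hy, rfl⟩
    exact ⟨rankBound_complexify_iff.2 hy, y, rfl⟩
  · rintro ⟨hz, y, rfl⟩
    exact ⟨y, rankBound_complexify_iff.1 hz, rfl⟩
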